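/- **Setting.** Let $q\in(-1,1)$ (with $0^0=1$). Let $(\mathcal A,\varphi)$ be a $W^*$-probability space, i.e. a von Neumann algebra $\mathcal A$ on a complex Hilbert space together with a unital, positive, faithful, tracial, weakly continuous linear functional $\varphi$. A pairing of $\{1,\dots,N\}$ is a partition of it into sets of cardinality $2$; $\mathcal P_2(N)$ is the set of pairings, and $\mathrm{Cr}(\pi)$ is the number of sets $\{\{x_1,y_1\},\{x_2,y_2\}\}$ of pairs of $\pi$ with $x_1<x_2<y_1<y_2$. Let $X=\{X_t\}_{t\ge0}$ be a $q$-Brownian motion on $(\mathcal A,\varphi)$: a family of self-adjoint elements of $\mathcal A$ with, for all $r\ge1$ and $t_1,\dots,t_r\ge0$, $$\varphi(X_{t_1}\cdots X_{t_r})=\sum_{\pi\in\mathcal P_2(r)}q^{\mathrm{Cr}(\pi)}\prod_{\{i,j\}\in\pi}\min(t_i,t_j).$$ For $n\ge1$ put $I_n(f)=(X_{b_1}-X_{a_1})\cdots(X_{b_n}-X_{a_n})$ when $f=\mathbf 1_{(a_1,b_1)}\otimes\cdots\otimes\mathbf 1_{(a_n,b_n)}$ with pairwise disjoint intervals $(a_i,b_i)\subset\mathbb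 R_+$, and extend $I_n$ linearly to the span $\mathcal E_n$ of these indicators. For $f\in L^2(\mathbb R_+^n)$, the multiple integral $I_n(f)$ is the element of $\mathcal A$ such that there are $f_k\in\mathcal E_n$ with $f_k\to f$ in $L^2(\mathbb R_+^n)$ and $\varphi\big((I_n(f_k)-I_n(f))^*(I_n(f_k)-I_n(f))\big)\to0$. Let $n_1,\dots,n_r$ be positive integers, $N=n_1+\dots+n_r$, and cut $\{1,\dots,N\}$ into consecutive blocks $B_1,\dots,B_r$ of lengths $n_1,\dots,n_r$. Let $C_2(n_1\otimes\cdots\otimes n_r)$ be the set of $\pi\in\mathcal P_2(N)$ no pair of which is contained in a single block. For such $\pi$ and $f_i\in L^2(\mathbb R_+^{n_i})$, the pairing integral $\int_\pi f_1\otimes\cdots\otimes f_r$ is the integral over $\mathbb R_+^{N/2}$ of $f_1(t_1,\dots,t_{n_1})\,f_2(t_{n_1+1},\dots,t_{n_1+n_2})\cdots f_r(t_{N-n_r+1},\dots,t_N)$, in which $t_l$ and $t_m$ are identified for every pair $\{l,m\}\in\pi$, so that there is one variable of integration for each pair. **Theorem 2.7.** For all $f_1\in L^2(\mathbb R_+^{n_1}),\dots,f_r\in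 L^2(\mathbb R_+^{n_r})$, the elements $I_{n_i}(f_i)\in\mathcal A$ exist and are unique, the integrals $\int_\pi f_1\otimes\cdots\otimes f_r$, $\pi\in C_2(n_1\otimes\cdots\otimes n_r)$, converge absolutely, and $$\varphi\big(I_{n_1}(f_1)\cdots I_{n_r}(f_r)\big)=\sum_{\pi\in C_2(n_1\otimes\cdots\otimes n_r)}q^{\mathrm{Cr}(\pi)}\int_\pi f_1\otimes\cdots\otimes f_r .$$ -/

import Mathlib

open MeasureTheory Filter Topology
open scoped NNReal ENNReal

noncomputable section

/-- A `W*`-probability space: a von Neumann algebra acting on the complex Hilbert space `H`,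
together with a unital, positive, faithful, tracial and weakly continuous linear functional. -/
structure WStarProbabilitySpace (H : Type*) [NormedAddCommGroup H] [InnerProductSpace ℂ H]
    [CompleteSpace H] where
  /-- the von Neumann algebra -/
  algebra : VonNeumannAlgebra H
  /-- the trace `φ` -/
  trace : algebra.toStarSubalgebra →ₗ[ℂ] ℂ
  trace_one : trace 1 = 1
  trace_nonneg : ∀ Y, 0 ≤ (trace (Y * star Y)).re ∧ (trace (Y * star Y)).im = 0
  faithful : ∀ Y, trace (Y * star Y) = 0 → Y = 0
  tracial : ∀ Y Z, trace (Y * Z) = trace (Z * Y)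
  /-- Weak continuity: if bounded elements converge in the weak operator topology, then their
  traces converge. (Boundedness is what makes this normality in general; a functional that is
  continuous for the weak operator topology on the whole algebra satisfies it a fortiori.) -/
  weakly_continuous : ∀ (l : Filter algebra.toStarSubalgebra) (Y : algebra.toStarSubalgebra),
    (∃ R : ℝ, ∀ᶠ Z : algebra.toStarSubalgebra in l, ‖(Z : H →L[ℂ] H)‖ ≤ R) →
    (∀ x y : H, Tendsto (fun Z : algebra.toStarSubalgebra => inner ℂ x ((Z : H →L[ℂ] H) y)) l
      (𝓝 (inner ℂ x ((Y : H →L[ℂ] H) y)))) →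
    Tendsto trace l (𝓝 (trace Y))

/-- The elements of the von Neumann algebra of a `W*`-probability space. -/
abbrev WStarProbabilitySpace.Carrier {H : Type*} [NormedAddCommGroup H] [InnerProductSpace ℂ H]
    [CompleteSpace H] (P : WStarProbabilitySpace H) : Type _ :=
  P.algebra.toStarSubalgebra

/-- A pairing of `{0, …, N - 1}`, i.e. a partition into blocks of cardinality two, encoded by the
fixed-point-free involution that exchanges the two elements of each block. -/
abbrev Pairing (N : ℕ) : Type :=
  {π : Equiv.Perm (Fin N) // ∀ l, π (π l) = l ∧ π l ≠ l}

namespace Pairing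

variable {N : ℕ}

/-- The left end points of the pairs of `π`; each pair `{l, π l}` has exactly one. -/
abbrev Left (π : Pairing N) : Type := {l : Fin N // l < π.1 l}

/-- The left end point of the pair that contains `l`. -/
def left (π : Pairing N) (l : Fin N) : π.Left :=
  if h : l < π.1 l then ⟨l, h⟩
  else ⟨π.1 l, by
    rw [(π.2 l).1]
    exact lt_of_le_of_ne (not_lt.mp h) (π.2 l).2⟩

/-- The number of crossings `{{x₁, y₁}, {x₂, y₂}}`, `x₁ < x₂ < y₁ < y₂`, of `π`; a crossing is
determined by `(x₁, x₂)`, as `y₁ = π x₁` and `y₂ = π x₂`. -/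
def crossings (π : Pairing N) : ℕ :=
  (Finset.univ.filter fun x : Fin N × Fin N =>
    x.1 < x.2 ∧ x.2 < π.1 x.1 ∧ π.1 x.1 < π.1 x.2).card

end Pairing

/-- `{X t}_{t ≥ 0}` is a `q`-Brownian motion on the `W*`-probability space `P`. -/
structure IsQBrownianMotion {H : Type*} [NormedAddCommGroup H] [InnerProductSpace ℂ H]
    [CompleteSpace H] (P : WStarProbabilitySpace H) (q : ℝ) (X : ℝ≥0 → P.Carrier) : Prop where
  isSelfAdjoint : ∀ t, IsSelfAdjoint (X t)
  joint_moments : ∀ r : ℕ, 1 ≤ r → ∀ t : Fin r → ℝ≥0,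
    P.trace (List.ofFn fun i => X (t i)).prod =
      ∑ π : Pairing r, (q : ℂ) ^ π.crossings *
        ∏ l : π.Left, ((min (t l.1) (t (π.1 l.1)) : ℝ≥0) : ℂ)

/-- Lebesgue measure on `ℝ₊^ι`, viewed as a measure on `ℝ^ι` carried by `ℝ₊^ι`. -/
def halfLebesgue (ι : Type*) [Fintype ι] : Measure (ι → ℝ) :=
  Measure.pi fun _ => (volume : Measure ℝ).restrict (Set.Ici 0)

/-- A product `(a₁, b₁) × ⋯ × (aₙ, bₙ)` of pairwise disjoint bounded open intervals of `ℝ₊`. -/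
structure OffDiagonalBox (n : ℕ) where
  a : Fin n → ℝ≥0
  b : Fin n → ℝ≥0
  lt : ∀ i, a i < b i
  disjoint : Pairwise fun i j => Disjoint (Set.Ioo (a i) (b i)) (Set.Ioo (a j) (b j))

namespace OffDiagonalBox

variable {n : ℕ}

/-- The indicator function `1_{(a₁, b₁)}(t₁) ⋯ 1_{(aₙ, bₙ)}(tₙ)` of a box. -/
def indicator (B : OffDiagonalBox n) (t : Fin n → ℝ) : ℂ :=
  ∏ i, (Set.Ioo (B.a i : ℝ) (B.b i : ℝ)).indicator (fun _ => (1 : ℂ)) (t i)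

variable {H : Type*} [NormedAddCommGroup H] [InnerProductSpace ℂ H] [CompleteSpace H]
  {P : WStarProbabilitySpace H}

/-- The product `(X_{b₁} - X_{a₁}) ⋯ (X_{bₙ} - X_{aₙ})` of increments, in this order. -/
def increment (X : ℝ≥0 → P.Carrier) (B : OffDiagonalBox n) : P.Carrier :=
  (List.ofFn fun i => X (B.b i) - X (B.a i)).prod

end OffDiagonalBox

/-- A finite formal linear combination of indicators of off-diagonal boxes. -/
abbrev SimpleIntegrand (n : ℕ) : Type := OffDiagonalBox n →₀ ℂ

namespace SimpleIntegrand

variable {n : ℕ}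

/-- The simple function, vanishing on diagonals, that a formal combination represents. -/
def toFun (s : SimpleIntegrand n) (t : Fin n → ℝ) : ℂ :=
  s.sum fun B c => c * B.indicator t

variable {H : Type*} [NormedAddCommGroup H] [InnerProductSpace ℂ H] [CompleteSpace H]
  {P : WStarProbabilitySpace H}

/-- The multiple integral of a simple function with respect to `X`, defined by linearity. -/
def integral (X : ℝ≥0 → P.Carrier) (s : SimpleIntegrand n) : P.Carrier :=
  s.sum fun B c => c • B.increment X

end SimpleIntegrand

/-- `Y` is the multiple integral `∫ f(t₁, …, tₙ) dX_{t₁} ⋯ dX_{tₙ}`: for some simple functions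
`sₖ`, vanishing on diagonals, `sₖ → f` in `L²(ℝ₊ⁿ)` and the integrals of the `sₖ` converge to `Y`
in `L²(𝒜, φ)`. -/
def IsMultipleIntegral {H : Type*} [NormedAddCommGroup H] [InnerProductSpace ℂ H]
    [CompleteSpace H] {P : WStarProbabilitySpace H} (X : ℝ≥0 → P.Carrier) {n : ℕ}
    (f : (Fin n → ℝ) → ℂ) (Y : P.Carrier) : Prop :=
  ∃ s : ℕ → SimpleIntegrand n,
    Tendsto (fun k => eLpNorm (fun t => (s k).toFun t - f t) 2 (halfLebesgue (Fin n)))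
      atTop (𝓝 0) ∧
    Tendsto (fun k => P.trace (star ((s k).integral X - Y) * ((s k).integral X - Y)))
      atTop (𝓝 0)

namespace Pairing

variable {r : ℕ} {n : Fin r → ℕ}

/-- The index `i` of the block of `n₁ ⊗ ⋯ ⊗ nᵣ` that contains `l`, where
`{0, …, n₁ + ⋯ + nᵣ - 1}` is cut into consecutive blocks of lengths `n₁, …, nᵣ`. -/
def blockIndex (l : Fin (∑ i, n i)) : Fin r := (finSigmaFinEquiv.symm l).1

/-- `π` respects `n₁ ⊗ ⋯ ⊗ nᵣ`: no pair of `π` has both its elements in the same block. -/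
def Respects (π : Pairing (∑ i, n i)) : Prop :=
  ∀ l, blockIndex l ≠ blockIndex (π.1 l)

instance (π : Pairing (∑ i, n i)) : Decidable π.Respects :=
  inferInstanceAs (Decidable (∀ l, blockIndex l ≠ blockIndex (π.1 l)))

/-- The function `f₁ ⊗ ⋯ ⊗ fᵣ` of `(t₁, …, t_N)`, `N = n₁ + ⋯ + nᵣ`, in which the variables
`t_l` and `t_m` are identified for every pair `{l, m}` of `π`. -/
def integrand (π : Pairing (∑ i, n i)) (f : ∀ i, (Fin (n i) → ℝ) → ℂ) (t : π.Left → ℝ) : ℂ :=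
  ∏ i, f i fun j => t (π.left (finSigmaFinEquiv ⟨i, j⟩))

/-- The pairing integral: `f₁ ⊗ ⋯ ⊗ fᵣ` is integrated against `∏_{{l, m} ∈ π} δ(t_l - t_m)`,
that is, with one variable of integration in `ℝ₊` for each pair of `π`. -/
def integral (π : Pairing (∑ i, n i)) (f : ∀ i, (Fin (n i) → ℝ) → ℂ) : ℂ :=
  ∫ t, π.integrand f t ∂(halfLebesgue π.Left)

end Pairing

end

/-! For off-diagonal boxes the formula is a computation. Both sides of the moment formula of `X` are
multilinear in formal combinations of times, so it passes to increments. The covariance of two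
increments is the overlap length of their intervals, that is, the integral of the product of their
indicators. A pair inside one block contributes the overlap of two disjoint sides, hence zero, so
only respecting pairings survive; for these the product over pairs is the pairing integral by
Fubini. Multilinearity gives all simple integrands (`trace_prod_simpleIntegrand`).

The rest is continuity. Each pairing integral is at most the product of the `L²` norms: every
variable occurs in exactly two functions, so Cauchy–Schwarz can be applied one variable at a time
(`lmarginal_prod_le_prod_lmarginal_sq`). On the algebra side convergence in `L²(𝒜, φ)` is too weak
to pass to products, so the integral has to be bounded in operator norm. A faithful trace sees that
norm through the growth of the moments of `star Z * Z` (`norm_star_mul_self_le_of_moments`). For a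
simple integral these moments are again sums over pairings, and a pairing is determined by its left
end points and its crossing numbers, so `∑ |q| ^ crossings` grows only exponentially
(`Pairing.sum_pow_crossings_le`). This yields `‖I_n(s)‖ ≤ (2 / (1 - |q|)) ^ n * ‖s‖`.

Simple integrands being dense (`SimpleIntegrand.denseRange_toLp`), the integral extends to a bounded
operator on `L²`, and both sides of the formula are continuous and agree on a dense set. Uniqueness
is faithfulness of the trace. -/

noncomputable section

/-! ### Operator norm and `L²` distance from a faithful trace. -/

/-- A faithful positive functional on a C⋆-algebra determines the norm of `star Z * Z` through its
moments. -/
theorem norm_star_mul_self_le_of_moments {A : Type*} [CStarAlgebra A] [Nontrivial A]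
    (φ : A →ₗ[ℂ] ℂ) (hpos : ∀ Y, 0 ≤ (φ (Y * star Y)).re ∧ (φ (Y * star Y)).im = 0)
    (hfaith : ∀ Y, φ (Y * star Y) = 0 → Y = 0) (Z : A) {D : ℝ} (hD : 0 ≤ D)
    (h : ∀ m : ℕ, (φ ((star Z * Z) ^ m)).re ≤ D ^ m) : ‖star Z * Z‖ ≤ D := by
  let _ := CStarAlgebra.spectralOrder A
  have _ := CStarAlgebra.spectralOrderedRing A
  set a : A := star Z * Z with ha
  have ha0 : 0 ≤ a := star_mul_self_nonneg Z
  have hsa : IsSelfAdjoint a := ha0.isSelfAdjoint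
  have hsq : ∀ g : ℝ → ℝ, Continuous g → cfc (fun x => g x * g x) a = cfc g a * star (cfc g a) := by
    intro g hg
    rw [(cfc_predicate g a : IsSelfAdjoint (cfc g a)).star_eq,
      cfc_mul g g a hg.continuousOn hg.continuousOn]
  by_contra! hlt
  obtain ⟨l, hDl, hl⟩ := exists_between hlt
  have hl0 : 0 < l := hD.trans_lt hDl
  -- A bump supported above `l` and nonzero at `‖a‖`; the cap at 1 gives `l ^ m * k² ≤ x ^ m` on the
  -- spectrum. Taking traces, `l ^ m * δ ≤ D ^ m` for all `m`, impossible when `D < l`.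
  let k : ℝ → ℝ := fun x => min (max (x - l) 0) 1
  have hk : Continuous k := by fun_prop
  have hk0 : ∀ x, 0 ≤ k x := fun x => le_min (le_max_right _ _) zero_le_one
  have hk1 : ∀ x, k x ≤ 1 := fun x => min_le_right _ _
  have hkne : cfc k a ≠ 0 := by
    intro h0
    have h1 : k ‖a‖ ∈ spectrum ℝ (cfc k a) := by
      rw [cfc_map_spectrum k a hsa hk.continuousOn]
      exact ⟨_, CStarAlgebra.norm_mem_spectrum_of_nonneg ha0, rfl⟩
    rw [h0, spectrum.zero_eq] at h1
    have h2 : 0 < k ‖a‖ := lt_min (lt_max_of_lt_left (sub_pos.mpr hl)) one_pos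
    exact h2.ne' h1
  set δ : ℝ := (φ (cfc k a * star (cfc k a))).re with hδ
  have hδ0 : 0 < δ := by
    refine lt_of_le_of_ne (hpos _).1 fun h0 => hkne (hfaith _ ?_)
    exact Complex.ext h0.symm (hpos _).2
  have key : ∀ m : ℕ, l ^ m * δ ≤ D ^ m := by
    intro m
    refine le_trans ?_ (h m)
    -- The square root writes the difference as `Y * star Y`, the form in which positivity of `φ` is
    -- assumed.
    let g : ℝ → ℝ := fun x => √(max (x ^ m - l ^ m * (k x * k x)) 0)
    have hg : Continuous g := by fun_prop
    have hgg : cfc (fun x => g x * g x) a = a ^ m - (l ^ m : ℝ) • (cfc k a * star (cfc k a)) := by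
      rw [← hsq k hk, ← cfc_pow_id (R := ℝ) a m, ← cfc_smul (l ^ m : ℝ) _ a
        (by fun_prop), ← cfc_sub _ _ a (by fun_prop) (by fun_prop)]
      refine cfc_congr fun x hx => ?_
      have hx0 : 0 ≤ x := spectrum_nonneg_of_nonneg ha0 hx
      simp only [g, smul_eq_mul]
      rw [Real.mul_self_sqrt (le_max_right _ _), max_eq_left]
      rw [sub_nonneg]
      rcases le_total x l with hxl | hxl
      · have : k x = 0 := by
          simp only [k]; rw [max_eq_right (by linarith)]; simp
        rw [this]; simp; positivity
      · calc l ^ m * (k x * k x) ≤ l ^ m * 1 := by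
              gcongr; exact mul_le_one₀ (hk1 x) (hk0 x) (hk1 x)
          _ ≤ x ^ m := by rw [mul_one]; gcongr
    have h3 := (hpos (cfc g a)).1
    rw [← hsq g hg, hgg, map_sub, ← algebraMap_smul ℂ (l ^ m : ℝ), map_smul, Complex.sub_re] at h3
    simp only [Complex.coe_algebraMap, smul_eq_mul, Complex.re_ofReal_mul] at h3
    linarith
  have hlim : Tendsto (fun m : ℕ => (D / l) ^ m) atTop (𝓝 0) :=
    tendsto_pow_atTop_nhds_zero_of_lt_one (by positivity) ((div_lt_one hl0).mpr hDl)
  refine absurd (ge_of_tendsto' hlim fun m => ?_) (not_le.mpr hδ0)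
  rw [div_pow, le_div_iff₀ (by positivity), mul_comm]
  exact key m

/-- A double commutant is a centralizer, hence norm closed. The carrier is thus complete, as
functional calculus and extension by density require. -/
instance VonNeumannAlgebra.isClosed_toStarSubalgebra {H : Type*} [NormedAddCommGroup H]
    [InnerProductSpace ℂ H] [CompleteSpace H] (A : VonNeumannAlgebra H) :
    IsClosed (A.toStarSubalgebra : Set (H →L[ℂ] H)) := by
  have h : (A.toStarSubalgebra : Set (H →L[ℂ] H)) = _ := A.centralizer_centralizer'.symm
  rw [h]
  exact Set.isClosed_centralizer _

namespace WStarProbabilitySpace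

variable {H : Type*} [NormedAddCommGroup H] [InnerProductSpace ℂ H] [CompleteSpace H]
  (P : WStarProbabilitySpace H)

/-- Norm convergence implies weak operator convergence and eventual boundedness, so weak continuity
applies. -/
theorem continuous_trace : Continuous P.trace := by
  rw [continuous_iff_continuousAt]
  intro Y
  refine P.weakly_continuous (𝓝 Y) Y ⟨‖Y‖ + 1, ?_⟩ fun x y => ?_
  · have : Tendsto (fun Z : P.Carrier => ‖Z‖) (𝓝 Y) (𝓝 ‖Y‖) := continuous_norm.tendsto Y
    exact this.eventually_le_const (lt_add_one _)
  · have : Continuous fun Z : P.Carrier => inner ℂ x ((Z : H →L[ℂ] H) y) := by fun_prop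
    exact this.tendsto Y

instance nontrivial_carrier : Nontrivial P.Carrier := by
  refine ⟨⟨1, 0, fun h => ?_⟩⟩
  have := P.trace_one
  rw [h, map_zero] at this
  exact zero_ne_one this

theorem norm_le_of_moments (Z : P.Carrier) {D : ℝ} (hD : 0 ≤ D)
    (h : ∀ m : ℕ, (P.trace ((star Z * Z) ^ m)).re ≤ (D ^ 2) ^ m) : ‖Z‖ ≤ D := by
  have := norm_star_mul_self_le_of_moments P.trace P.trace_nonneg P.faithful Z (sq_nonneg D) h
  rw [CStarRing.norm_star_mul_self, ← sq] at this
  exact le_of_sq_le_sq this hD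

theorem trace_star_mul_self_nonneg (Y : P.Carrier) :
    0 ≤ (P.trace (star Y * Y)).re ∧ (P.trace (star Y * Y)).im = 0 := by
  rw [P.tracial]
  exact P.trace_nonneg Y

theorem eq_zero_of_trace_star_mul_self (Y : P.Carrier) (h : P.trace (star Y * Y) = 0) : Y = 0 :=
  P.faithful Y (by rw [P.tracial, h])

/-- The squared `L²(𝒜, φ)` seminorm satisfies the quasi-triangle inequality. -/
theorem trace_star_mul_self_add_le (Y Z : P.Carrier) :
    (P.trace (star (Y + Z) * (Y + Z))).re ≤
      2 * (P.trace (star Y * Y)).re + 2 * (P.trace (star Z * Z)).re := by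
  have h := (P.trace_star_mul_self_nonneg (Y - Z)).1
  -- The parallelogram identity; the term of `Y - Z` is then dropped by positivity.
  have e : star (Y + Z) * (Y + Z) + star (Y - Z) * (Y - Z) =
      (2 : ℂ) • (star Y * Y) + (2 : ℂ) • (star Z * Z) := by
    simp only [star_add, star_sub, two_smul]; noncomm_ring
  have e' := congrArg (fun W => (P.trace W).re) e
  simp only [map_add, map_smul, Complex.add_re, smul_eq_mul, Complex.mul_re, Complex.re_ofNat,
    Complex.im_ofNat, zero_mul, sub_zero] at e'
  linarith

/-- A family whose `L²(𝒜, φ)` distances to `Y` and to `Z` tend to zero forces `Y = Z`. -/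
theorem eq_of_tendsto_trace {W : ℕ → P.Carrier} {Y Z : P.Carrier}
    (hY : Tendsto (fun k => P.trace (star (W k - Y) * (W k - Y))) atTop (𝓝 0))
    (hZ : Tendsto (fun k => P.trace (star (W k - Z) * (W k - Z))) atTop (𝓝 0)) : Y = Z := by
  have hre : Tendsto (fun k => 2 * (P.trace (star (W k - Z) * (W k - Z))).re +
      2 * (P.trace (star (W k - Y) * (W k - Y))).re) atTop (𝓝 0) := by
    have h1 := (Complex.continuous_re.tendsto _).comp hY
    have h2 := (Complex.continuous_re.tendsto _).comp hZ
    simpa using (h2.const_mul 2).add (h1.const_mul 2)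
  have hle : (P.trace (star (Y - Z) * (Y - Z))).re ≤ 0 := by
    refine ge_of_tendsto' hre fun k => ?_
    have h := P.trace_star_mul_self_add_le (W k - Z) (-(W k - Y))
    rw [show W k - Z + -(W k - Y) = Y - Z by abel, star_neg, neg_mul_neg] at h
    exact h
  have h0 := P.trace_star_mul_self_nonneg (Y - Z)
  exact sub_eq_zero.mp (P.eq_zero_of_trace_star_mul_self _
    (Complex.ext (le_antisymm hle h0.1) h0.2))

end WStarProbabilitySpace

/-! ### Counting pairings by crossings. -/

namespace Pairing

variable {N : ℕ}

theorem apply_apply (π : Pairing N) (l : Fin N) : π.1 (π.1 l) = l := (π.2 l).1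

theorem apply_ne (π : Pairing N) (l : Fin N) : π.1 l ≠ l := (π.2 l).2

/-- The number of pairs that cross the pair of `y` from the right, when `y` is a right end point. -/
def crossingsAt (π : Pairing N) (y : Fin N) : ℕ :=
  (Finset.univ.filter fun x : Fin N => π.1 y < x ∧ x < y ∧ y < π.1 x).card

/-- Each crossing is charged to the smaller of its two right end points; left end points are charged
nothing. -/
theorem crossings_eq_sum (π : Pairing N) : π.crossings = ∑ y, π.crossingsAt y := by
  unfold crossings crossingsAt
  rw [← Finset.card_sigma]
  refine Finset.card_bij (fun x _ => ⟨π.1 x.1, x.2⟩) ?_ ?_ ?_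
  · intro x hx
    simpa [π.apply_apply] using hx
  · rintro ⟨a, b⟩ _ ⟨c, d⟩ _ h
    simpa using h
  · rintro ⟨a, b⟩ h
    refine ⟨(π.1 a, b), ?_, ?_⟩
    · simpa [π.apply_apply] using h
    · simp [π.apply_apply]

/-- Scan from left to right. If the pairs closed before `y` agree, then the same left end points are
open at `y` for both pairings, and `crossingsAt y` counts those strictly between the partner of `y`
and `y`. Moving the partner to the right loses at least one: `σ.1 y` itself is counted for `π` but
not for `σ`. -/
theorem crossingsAt_lt {π σ : Pairing N} (ho : ∀ l, l < π.1 l ↔ l < σ.1 l) {y : Fin N}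
    (ih : ∀ z < y, π.1 z < z → σ.1 z = π.1 z) (h : π.1 y < σ.1 y) (hy : σ.1 y < y) :
    σ.crossingsAt y < π.crossingsAt y := by
  have key : ∀ x, x < y → x < π.1 x → π.1 x < y → σ.1 x = π.1 x := by
    intro x _ hx1 hx2
    have := ih (π.1 x) hx2 (by rwa [π.apply_apply])
    rw [π.apply_apply] at this
    rw [← σ.apply_apply (π.1 x), this]
  unfold crossingsAt
  refine Finset.card_lt_card ⟨fun x hx => ?_, fun hsub => ?_⟩
  · simp only [Finset.mem_filter, Finset.mem_univ, true_and] at hx ⊢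
    obtain ⟨h1, h2, h3⟩ := hx
    refine ⟨h.trans h1, h2, ?_⟩
    have hx1 : x < π.1 x := (ho x).2 (h2.trans h3)
    by_contra! hle
    rcases hle.lt_or_eq with hlt | heq
    · rw [key x h2 hx1 hlt] at h3
      exact absurd (h3.trans hlt) (lt_irrefl _)
    · have : x = π.1 y := by rw [← heq, π.apply_apply]
      rw [this] at h1
      exact absurd (h1.trans h) (lt_irrefl _)
  · have hmem : σ.1 y ∈ Finset.univ.filter fun x : Fin N => π.1 y < x ∧ x < y ∧ y < π.1 x := by
      simp only [Finset.mem_filter, Finset.mem_univ, true_and]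
      refine ⟨h, hy, ?_⟩
      have hx1 : σ.1 y < π.1 (σ.1 y) := (ho _).2 (by rwa [σ.apply_apply])
      by_contra! hle
      rcases hle.lt_or_eq with hlt | heq
      · have := key _ hy hx1 hlt
        rw [σ.apply_apply] at this
        exact absurd hlt (by rw [← this]; exact lt_irrefl _)
      · have : σ.1 y = π.1 y := by
          conv_rhs => rw [← heq]
          rw [π.apply_apply]
        exact h.ne' this
    have := hsub hmem
    simp at this

/-- A pairing is determined by its left end points and the numbers `crossingsAt`. -/
theorem eq_of_crossingsAt {π σ : Pairing N} (ho : ∀ l, l < π.1 l ↔ l < σ.1 l)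
    (hc : ∀ y, π.crossingsAt y = σ.crossingsAt y) : π = σ := by
  have ho' : ∀ l, π.1 l < l ↔ σ.1 l < l := fun l => by
    have h1 := π.apply_ne l
    have h2 := σ.apply_ne l
    have := ho l
    constructor
    · exact fun h => lt_of_le_of_ne (not_lt.mp fun h' => (h.trans (this.2 h')).false) h2
    · exact fun h => lt_of_le_of_ne (not_lt.mp fun h' => (h.trans (this.1 h')).false) h1
  have main : ∀ y, π.1 y < y → σ.1 y = π.1 y := by
    intro y
    induction y using WellFoundedLT.induction with
    | ind y ih =>
      intro hy
      rcases lt_trichotomy (π.1 y) (σ.1 y) with h | h | h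
      · exact absurd (hc y) (crossingsAt_lt ho ih h ((ho' y).1 hy)).ne'
      · exact h.symm
      · refine absurd (hc y) (crossingsAt_lt (fun l => (ho l).symm) (fun z hz hz' => ?_) h hy).ne
        exact (ih z hz ((ho' z).2 hz')).symm
  refine Subtype.ext (Equiv.ext fun l => ?_)
  rcases lt_or_gt_of_ne (π.apply_ne l) with h | h
  · exact (main l h).symm
  · have := main (π.1 l) (by rwa [π.apply_apply])
    rw [π.apply_apply] at this
    rw [← σ.apply_apply (π.1 l), this]

/-- The generating function of the crossing numbers grows at most exponentially. -/
theorem sum_pow_crossings_le {p : ℝ} (hp0 : 0 ≤ p) (hp1 : p < 1) (N : ℕ) :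
    ∑ π : Pairing N, p ^ π.crossings ≤ (2 * (1 - p)⁻¹) ^ N := by
  -- The code of a pairing: its left end points, giving the factor `2 ^ N`, and its crossing
  -- numbers. The weight is a product over positions, so summing over all codes gives a geometric
  -- sum at each one.
  let e : Pairing N → (Fin N → Bool) × (Fin N → Fin (N + 1)) := fun π =>
    (fun l => decide (l < π.1 l), fun y => ⟨π.crossingsAt y, Nat.lt_succ_of_le
      ((Finset.card_le_univ _).trans_eq (Fintype.card_fin N))⟩)
  have he : Function.Injective e := by
    intro π σ h
    simp only [e, Prod.mk.injEq, funext_iff, decide_eq_decide, Fin.mk.injEq] at h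
    exact eq_of_crossingsAt h.1 h.2
  calc ∑ π : Pairing N, p ^ π.crossings
      = ∑ π : Pairing N, ∏ y, p ^ ((e π).2 y : ℕ) := by
        refine Finset.sum_congr rfl fun π _ => ?_
        rw [crossings_eq_sum, ← Finset.prod_pow_eq_pow_sum]
    _ = ∑ x ∈ Finset.univ.image e, ∏ y, p ^ (x.2 y : ℕ) := by
        rw [Finset.sum_image he.injOn]
    _ ≤ ∑ x : (Fin N → Bool) × (Fin N → Fin (N + 1)), ∏ y, p ^ (x.2 y : ℕ) :=
        Finset.sum_le_univ_sum_of_nonneg fun x => Finset.prod_nonneg fun y _ => pow_nonneg hp0 _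
    _ = 2 ^ N * (∑ k : Fin (N + 1), p ^ (k : ℕ)) ^ N := by
        rw [Fintype.sum_prod_type, Fintype.sum_pow]
        simp
    _ ≤ 2 ^ N * ((1 - p)⁻¹) ^ N := by
        gcongr
        rw [Fin.sum_univ_eq_sum_range (fun k => p ^ k), ← tsum_geometric_of_lt_one hp0 hp1]
        exact (summable_geometric_of_lt_one hp0 hp1).sum_le_tsum _ fun _ _ => pow_nonneg hp0 _
    _ = (2 * (1 - p)⁻¹) ^ N := (mul_pow _ _ _).symm

end Pairing

/-! ### The contraction inequality for pairing integrals. -/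

/-- If every variable occurs in exactly two of the functions `G k`, then the integral of `∏ k, G k`
is at most the product of the `L²` norms of the functions. -/
theorem lmarginal_prod_le_prod_lmarginal_sq {L κ : Type*} [DecidableEq L] [Fintype κ]
    [DecidableEq κ] {α : Type*} [MeasurableSpace α] {μ : L → Measure α} [∀ x, SigmaFinite (μ x)]
    (A : κ → Finset L) (G : κ → (L → α) → ℝ≥0∞) (hG : ∀ k, Measurable (G k))
    (hdep : ∀ k, ∀ x ∉ A k, ∀ t y, G k (Function.update t x y) = G k t)
    (hA : ∀ x, ∃ i j, i ≠ j ∧ ∀ k, x ∈ A k ↔ k = i ∨ k = j) (s : Finset L) (t : L → α) :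
    lmarginal μ s (fun t => ∏ k, G k t) t ≤
      ∏ k, (lmarginal μ (s ∩ A k) (fun t => G k t ^ (2 : ℝ)) t) ^ (1 / 2 : ℝ) := by
  have hG2 : ∀ k, Measurable fun t => G k t ^ (2 : ℝ) := fun k => (hG k).pow_const _
  induction s using Finset.induction generalizing t with
  | empty =>
    simp only [lmarginal_empty, Finset.empty_inter]
    refine Finset.prod_le_prod' fun k _ => ?_
    rw [← ENNReal.rpow_mul]
    norm_num
  | insert x s hx ih =>
    -- Only the factors `i` and `j` depend on `x`: the others leave the integral over `x`, and
    -- Cauchy–Schwarz in this single variable separates these two.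
    obtain ⟨i, j, hij, hk⟩ := hA x
    set h : κ → (L → α) → ℝ≥0∞ := fun k => lmarginal μ (s ∩ A k) fun t => G k t ^ (2 : ℝ) with hh
    have hhm : ∀ k, Measurable (h k) := fun k => (hG2 k).lmarginal μ
    have hsplit : ∀ F : κ → ℝ≥0∞,
        ∏ k, F k = F i * F j * ∏ k ∈ (Finset.univ.erase i).erase j, F k := by
      intro F
      rw [mul_assoc, Finset.mul_prod_erase _ _ (Finset.mem_erase.mpr ⟨hij.symm, Finset.mem_univ _⟩),
        Finset.mul_prod_erase _ _ (Finset.mem_univ _)]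
    have hother : ∀ k ∈ (Finset.univ.erase i).erase j, x ∉ A k := by
      intro k hk'
      simp only [Finset.mem_erase, Finset.mem_univ, and_true] at hk'
      rw [hk]
      tauto
    have hconst : ∀ k ∈ (Finset.univ.erase i).erase j, ∀ y,
        h k (Function.update t x y) = h k t := by
      intro k hk' y
      have hxk := hother k hk'
      simp only [hh]
      rw [lmarginal_update_of_notMem (hG2 k) (by simp [hxk])]
      congr 1
      funext t'
      simp [hdep k x hxk]
    have hmem : ∀ k, x ∈ A k →
        lmarginal μ (insert x s ∩ A k) (fun t => G k t ^ (2 : ℝ)) t =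
          ∫⁻ y, h k (Function.update t x y) ∂μ x := by
      intro k hxk
      rw [Finset.insert_inter_of_mem hxk, lmarginal_insert _ (hG2 k) (by simp [hx])]
    have hup : Measurable fun y : α => Function.update t x y := measurable_update t
    rw [lmarginal_insert _ (Finset.measurable_fun_prod _ fun k _ => hG k) hx]
    calc ∫⁻ y, lmarginal μ s (fun t => ∏ k, G k t) (Function.update t x y) ∂μ x
        ≤ ∫⁻ y, ∏ k, h k (Function.update t x y) ^ (1 / 2 : ℝ) ∂μ x :=
          lintegral_mono fun y => ih _
      _ = ∫⁻ y, h i (Function.update t x y) ^ (1 / 2 : ℝ) *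
            h j (Function.update t x y) ^ (1 / 2 : ℝ) *
            ∏ k ∈ (Finset.univ.erase i).erase j, h k t ^ (1 / 2 : ℝ) ∂μ x := by
          refine lintegral_congr fun y => ?_
          rw [hsplit]
          congr 1
          exact Finset.prod_congr rfl fun k hk' => by rw [hconst k hk']
      _ = (∫⁻ y, h i (Function.update t x y) ^ (1 / 2 : ℝ) *
            h j (Function.update t x y) ^ (1 / 2 : ℝ) ∂μ x)
            * ∏ k ∈ (Finset.univ.erase i).erase j, h k t ^ (1 / 2 : ℝ) := by
          rw [lintegral_mul_const]
          exact (((hhm i).comp hup).pow_const _).mul (((hhm j).comp hup).pow_const _)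
      _ ≤ (∫⁻ y, h i (Function.update t x y) ∂μ x) ^ (1 / 2 : ℝ) *
            (∫⁻ y, h j (Function.update t x y) ∂μ x) ^ (1 / 2 : ℝ)
            * ∏ k ∈ (Finset.univ.erase i).erase j, h k t ^ (1 / 2 : ℝ) := by
          gcongr
          exact ENNReal.lintegral_mul_norm_pow_le ((hhm i).comp hup).aemeasurable
            ((hhm j).comp hup).aemeasurable (by norm_num) (by norm_num) (by norm_num)
      _ = _ := by
          rw [hsplit fun k =>
              lmarginal μ (insert x s ∩ A k) (fun t => G k t ^ (2 : ℝ)) t ^ (1 / 2 : ℝ),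
            hmem i ((hk i).2 (.inl rfl)), hmem j ((hk j).2 (.inr rfl))]
          congr 1
          refine Finset.prod_congr rfl fun k hk' => ?_
          rw [Finset.insert_inter_of_notMem (hother k hk')]

/-- The map `t ↦ t ∘ e` for injective `e` is quasi-measure-preserving between product measures. -/
theorem quasiMeasurePreserving_comp_injective {ι L : Type*} [Fintype ι] [Fintype L]
    {α : Type*} [MeasurableSpace α] (ν : Measure α) [SigmaFinite ν] {e : ι → L}
    (he : Function.Injective e) :
    Measure.QuasiMeasurePreserving (fun t : L → α => t ∘ e) (Measure.pi fun _ => ν)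
      (Measure.pi fun _ => ν) := by
  classical
  -- `t ↦ t ∘ e` is the projection onto the coordinates in the range of `e`, followed by a
  -- relabelling. It is only quasi-measure-preserving because the discarded coordinates need not
  -- have total mass one.
  obtain ⟨p, g, hg⟩ : ∃ (p : L → Prop) (g : {l // p l} ≃ ι), ∀ i, (g.symm i).1 = e i :=
    ⟨(· ∈ Set.range e), (Equiv.ofInjective e he).symm, fun i => rfl⟩
  have h1 := measurePreserving_piEquivPiSubtypeProd (fun _ : L => ν) p
  have h2 := Measure.quasiMeasurePreserving_fst (μ := Measure.pi fun _ : {l // p l} => ν)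
    (ν := Measure.pi fun _ : {l // ¬ p l} => ν)
  have h3 := measurePreserving_piCongrLeft (fun _ : ι => ν) g
  convert h3.quasiMeasurePreserving.comp (h2.comp h1.quasiMeasurePreserving) using 1
  funext t i
  obtain ⟨l, rfl⟩ := g.surjective i
  have := Equiv.piCongrLeft_apply_apply (fun _ : ι => α) g (fun l => t l.1) l
  refine Eq.trans ?_ this.symm
  simp [← hg]

instance (ι : Type*) [Fintype ι] : SigmaFinite (halfLebesgue ι) := by
  unfold halfLebesgue; infer_instance

namespace Pairing

section LeftEnd

variable {N : ℕ} (π : Pairing N)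

theorem left_eq_iff (l : Fin N) (x : π.Left) : π.left l = x ↔ l = x.1 ∨ l = π.1 x.1 := by
  have hx := x.2
  unfold left
  split_ifs with h
  · rw [Subtype.ext_iff]
    refine ⟨.inl, ?_⟩
    rintro (h' | h')
    · exact h'
    · rw [h', π.apply_apply] at h
      exact absurd (h.trans hx) (lt_irrefl _)
  · rw [Subtype.ext_iff]
    refine ⟨fun h' => .inr (by rw [← h', π.apply_apply]), ?_⟩
    rintro (h' | h')
    · rw [h'] at h; exact absurd hx h
    · change π.1 l = x.1
      rw [h', π.apply_apply]

theorem left_coe (x : π.Left) : π.left x.1 = x := (π.left_eq_iff _ _).2 (.inl rfl)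

theorem left_apply_coe (x : π.Left) : π.left (π.1 x.1) = x := (π.left_eq_iff _ _).2 (.inr rfl)

theorem eq_or_eq_of_left_eq {l m : Fin N} (h : π.left l = π.left m) : l = m ∨ l = π.1 m := by
  rcases (π.left_eq_iff l _).1 h with h1 | h1 <;> rcases (π.left_eq_iff m _).1 rfl with h2 | h2
  · exact .inl (h1.trans h2.symm)
  · right; rw [h2, π.apply_apply, h1]
  · right; rw [h1, ← h2]
  · exact .inl (h1.trans h2.symm)

/-- A product over all points is a product over the pairs. -/
theorem prod_eq_prod_left {M : Type*} [CommMonoid M] (g : Fin N → M) :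
    ∏ l, g l = ∏ x : π.Left, g x.1 * g (π.1 x.1) := by
  rw [← Finset.prod_fiberwise (s := Finset.univ) (g := π.left) (f := g)]
  refine Finset.prod_congr rfl fun x _ => ?_
  have : (Finset.univ.filter fun l => π.left l = x) = {x.1, π.1 x.1} := by
    ext l; simp [left_eq_iff]
  rw [this, Finset.prod_pair (π.apply_ne _).symm]

end LeftEnd

variable {r : ℕ} {n : Fin r → ℕ} (π : Pairing (∑ i, n i))

/-- The variable of a pairing integral that is substituted for the `j`-th argument of `f i`. -/
def slot (i : Fin r) (j : Fin (n i)) : π.Left := π.left (finSigmaFinEquiv ⟨i, j⟩)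

variable {π}

/-- Two arguments share a variable only when they are paired, which is forbidden within a block.
Injectivity makes substitution of variables preserve null sets, so that pairing integrals are well
defined on `L²` classes. -/
theorem Respects.slot_injective (hπ : π.Respects) (i : Fin r) : Function.Injective (π.slot i) := by
  intro j k h
  rcases π.eq_or_eq_of_left_eq h with h | h
  · simpa using h
  · refine absurd ?_ (hπ (finSigmaFinEquiv ⟨i, k⟩))
    rw [← h]
    simp [blockIndex]

/-- A variable enters through the two ends of its pair. For a respecting pairing the two blocks
differ, which is the exactly-two-occurrences hypothesis of the iterated Cauchy–Schwarz inequality.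
-/
theorem mem_image_slot (i : Fin r) (x : π.Left) :
    x ∈ Finset.univ.image (π.slot i) ↔ i = blockIndex x.1 ∨ i = blockIndex (π.1 x.1) := by
  have aux : ∀ l : Fin (∑ i, n i), i = blockIndex l ↔ ∃ j, finSigmaFinEquiv ⟨i, j⟩ = l := by
    intro l
    obtain ⟨⟨k, j⟩, rfl⟩ := finSigmaFinEquiv.surjective l
    simp only [blockIndex, Equiv.symm_apply_apply, EmbeddingLike.apply_eq_iff_eq]
    constructor
    · rintro rfl; exact ⟨j, rfl⟩
    · rintro ⟨j', h⟩; exact (Sigma.ext_iff.mp h).1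
  simp only [Finset.mem_image, Finset.mem_univ, true_and, slot, left_eq_iff, aux, exists_or]

theorem Respects.lintegral_prod_le (hπ : π.Respects) (g : ∀ i, (Fin (n i) → ℝ) → ℝ≥0∞)
    (hg : ∀ i, Measurable (g i)) :
    ∫⁻ t, ∏ i, g i (t ∘ π.slot i) ∂halfLebesgue π.Left ≤
      ∏ i, (∫⁻ t, g i t ^ (2 : ℝ) ∂halfLebesgue (Fin (n i))) ^ (1 / 2 : ℝ) := by
  have hcomp : ∀ i, Measurable fun t : π.Left → ℝ => t ∘ π.slot i := fun i =>
    measurable_pi_lambda _ fun j => measurable_pi_apply _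
  have key := lmarginal_prod_le_prod_lmarginal_sq
    (μ := fun _ : π.Left => (volume : Measure ℝ).restrict (Set.Ici 0))
    (fun i => Finset.univ.image (π.slot i)) (fun i t => g i (t ∘ π.slot i))
    (fun i => (hg i).comp (hcomp i)) ?_ ?_ Finset.univ 0
  · simp only [lmarginal_univ, Finset.univ_inter] at key
    refine key.trans_eq (Finset.prod_congr rfl fun i _ => ?_)
    have := lmarginal_image (μ := fun _ : π.Left => (volume : Measure ℝ).restrict (Set.Ici 0))
      (hπ.slot_injective i) Finset.univ (f := fun t => g i t ^ (2 : ℝ)) ((hg i).pow_const _) 0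
    rw [lmarginal_univ] at this
    exact congrArg (· ^ (1 / 2 : ℝ)) this
  · intro i x hx t y
    congr 1
    funext j
    have : π.slot i j ≠ x := fun h => hx (Finset.mem_image.mpr ⟨j, Finset.mem_univ _, h⟩)
    simp [Function.update_of_ne this]
  · exact fun x => ⟨_, _, hπ x.1, fun k => mem_image_slot k x⟩

theorem Respects.integrand_congr_ae (hπ : π.Respects) {f g : ∀ i, (Fin (n i) → ℝ) → ℂ}
    (h : ∀ i, f i =ᵐ[halfLebesgue (Fin (n i))] g i) :
    π.integrand f =ᵐ[halfLebesgue π.Left] π.integrand g := by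
  have : ∀ i, ∀ᵐ t ∂halfLebesgue π.Left, f i (t ∘ π.slot i) = g i (t ∘ π.slot i) := fun i =>
    (quasiMeasurePreserving_comp_injective _ (hπ.slot_injective i)).ae (h i)
  filter_upwards [ae_all_iff.mpr this] with t ht
  exact Finset.prod_congr rfl fun i _ => ht i

theorem Respects.integral_congr_ae (hπ : π.Respects) {f g : ∀ i, (Fin (n i) → ℝ) → ℂ}
    (h : ∀ i, f i =ᵐ[halfLebesgue (Fin (n i))] g i) : π.integral f = π.integral g :=
  MeasureTheory.integral_congr_ae (hπ.integrand_congr_ae h)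

theorem Respects.aestronglyMeasurable_integrand (hπ : π.Respects)
    {f : ∀ i, (Fin (n i) → ℝ) → ℂ}
    (hf : ∀ i, AEStronglyMeasurable (f i) (halfLebesgue (Fin (n i)))) :
    AEStronglyMeasurable (π.integrand f) (halfLebesgue π.Left) :=
  Finset.aestronglyMeasurable_fun_prod _ fun i _ =>
    (hf i).comp_quasiMeasurePreserving
      (quasiMeasurePreserving_comp_injective _ (hπ.slot_injective i))

/-- The contraction inequality for pairing integrals. -/
theorem Respects.lintegral_enorm_integrand_le (hπ : π.Respects) {f : ∀ i, (Fin (n i) → ℝ) → ℂ}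
    (hf : ∀ i, AEStronglyMeasurable (f i) (halfLebesgue (Fin (n i)))) :
    ∫⁻ t, ‖π.integrand f t‖ₑ ∂halfLebesgue π.Left ≤
      ∏ i, eLpNorm (f i) 2 (halfLebesgue (Fin (n i))) := by
  have h1 : ∫⁻ t, ‖π.integrand f t‖ₑ ∂halfLebesgue π.Left =
      ∫⁻ t, ‖π.integrand (fun i => (hf i).mk) t‖ₑ ∂halfLebesgue π.Left := by
    refine lintegral_congr_ae ?_
    filter_upwards [hπ.integrand_congr_ae fun i => (hf i).ae_eq_mk] with t ht
    rw [ht]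
  rw [h1]
  refine (le_of_eq ?_).trans ((hπ.lintegral_prod_le (fun i t => ‖(hf i).mk (f i) t‖ₑ) fun i =>
    (hf i).stronglyMeasurable_mk.measurable.enorm).trans_eq (Finset.prod_congr rfl fun i _ => ?_))
  · refine lintegral_congr fun t => ?_
    simp only [integrand, ← ofReal_norm, norm_prod]
    rw [ENNReal.ofReal_prod_of_nonneg fun _ _ => norm_nonneg _]
    rfl
  · rw [eLpNorm_congr_ae (hf i).ae_eq_mk,
      eLpNorm_eq_lintegral_rpow_enorm_toReal two_ne_zero ENNReal.ofNat_ne_top]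
    simp

theorem Respects.integrable_integrand (hπ : π.Respects) {f : ∀ i, (Fin (n i) → ℝ) → ℂ}
    (hf : ∀ i, MemLp (f i) 2 (halfLebesgue (Fin (n i)))) :
    Integrable (π.integrand f) (halfLebesgue π.Left) :=
  ⟨hπ.aestronglyMeasurable_integrand fun i => (hf i).1,
    (hπ.lintegral_enorm_integrand_le fun i => (hf i).1).trans_lt
      (ENNReal.prod_lt_top fun i _ => (hf i).2)⟩

theorem Respects.norm_integral_le (hπ : π.Respects)
    (f : ∀ i, Lp ℂ 2 (halfLebesgue (Fin (n i)))) :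
    ‖π.integral fun i => ⇑(f i)‖ ≤ ∏ i, ‖f i‖ := by
  simp only [Lp.norm_def]
  rw [← ENNReal.toReal_prod]
  refine (MeasureTheory.norm_integral_le_lintegral_norm _).trans ?_
  refine ENNReal.toReal_mono (ENNReal.prod_ne_top fun i _ => (Lp.memLp (f i)).2.ne) ?_
  simp only [ofReal_norm]
  exact hπ.lintegral_enorm_integrand_le fun i => (Lp.memLp (f i)).1

theorem integrand_update (f : ∀ i, (Fin (n i) → ℝ) → ℂ) (i : Fin r) (h : (Fin (n i) → ℝ) → ℂ)
    (t : π.Left → ℝ) : π.integrand (Function.update f i h) t =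
      h (t ∘ π.slot i) * ∏ k ∈ Finset.univ.erase i, f k (t ∘ π.slot k) := by
  unfold integrand
  rw [← Finset.mul_prod_erase _ _ (Finset.mem_univ i), Function.update_self]
  congr 1
  refine Finset.prod_congr rfl fun k hk => ?_
  rw [Function.update_of_ne (Finset.ne_of_mem_erase hk)]
  rfl

theorem coe_update_Lp (f : ∀ i, Lp ℂ 2 (halfLebesgue (Fin (n i)))) (i : Fin r)
    (v : Lp ℂ 2 (halfLebesgue (Fin (n i)))) :
    (fun k => ⇑(Function.update f i v k)) = Function.update (fun k => ⇑(f k)) i ⇑v :=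
  funext fun k =>
    Function.apply_update (fun k (g : Lp ℂ 2 (halfLebesgue (Fin (n k)))) => ⇑g) f i v k

/-- The pairing integral as a continuous multilinear map on `L²` spaces. -/
def Respects.integralCLM (hπ : π.Respects) :
    ContinuousMultilinearMap ℂ (fun i => Lp ℂ 2 (halfLebesgue (Fin (n i)))) ℂ :=
  MultilinearMap.mkContinuous
    { toFun := fun f => π.integral fun i => ⇑(f i)
      map_update_add' := by
        intro inst f i x y
        obtain rfl : inst = instDecidableEqFin r := Subsingleton.elim _ _
        have hint : ∀ v : Lp ℂ 2 (halfLebesgue (Fin (n i))), Integrable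
            (π.integrand (Function.update (fun k => ⇑(f k)) i ⇑v)) (halfLebesgue π.Left) := fun v => by
          rw [← coe_update_Lp]
          exact hπ.integrable_integrand fun k => Lp.memLp _
        simp only [coe_update_Lp]
        -- The representative of a sum in `Lp` is the sum of representatives only almost everywhere;
        -- the integral of a respecting pairing does not see the difference.
        have h1 : π.integral (Function.update (fun k => ⇑(f k)) i ⇑(x + y)) =
            π.integral (Function.update (fun k => ⇑(f k)) i (⇑x + ⇑y)) := by
          refine hπ.integral_congr_ae fun k => ?_
          by_cases hk : k = i
          · subst hk; simpa using Lp.coeFn_add x y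
          · simp [Function.update_of_ne hk]
        rw [h1]
        unfold integral
        rw [← integral_add (hint x) (hint y)]
        refine congrArg _ (funext fun t => ?_)
        simp only [integrand_update, Pi.add_apply, add_mul]
      map_update_smul' := by
        intro inst f i c x
        obtain rfl : inst = instDecidableEqFin r := Subsingleton.elim _ _
        simp only [coe_update_Lp]
        have h1 : π.integral (Function.update (fun k => ⇑(f k)) i ⇑(c • x)) =
            π.integral (Function.update (fun k => ⇑(f k)) i (c • ⇑x)) := by
          refine hπ.integral_congr_ae fun k => ?_
          by_cases hk : k = i
          · subst hk; simpa using Lp.coeFn_smul c x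
          · simp [Function.update_of_ne hk]
        rw [h1]
        unfold integral
        rw [← integral_smul]
        refine congrArg _ (funext fun t => ?_)
        simp only [integrand_update, Pi.smul_apply, smul_mul_assoc] }
    1 fun f => by rw [one_mul]; exact hπ.norm_integral_le f

theorem Respects.integralCLM_apply (hπ : π.Respects)
    (f : ∀ i, Lp ℂ 2 (halfLebesgue (Fin (n i)))) :
    hπ.integralCLM f = π.integral fun i => ⇑(f i) := rfl

end Pairing

/-! ### Moments of products of increments. -/

theorem List.prod_ofFn_finSigmaFinEquiv {M : Type*} [Monoid M] {r : ℕ} (n : Fin r → ℕ)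
    (g : Fin (∑ i, n i) → M) :
    (List.ofFn g).prod =
      (List.ofFn fun i => (List.ofFn fun j => g (finSigmaFinEquiv ⟨i, j⟩)).prod).prod := by
  induction r with
  | zero => rfl
  | succ r ih =>
    have hsum : ∑ i, n i = ∑ i : Fin r, n i.castSucc + n (Fin.last r) := Fin.sum_univ_castSucc n
    rw [List.ofFn_congr hsum, List.ofFn_add, List.prod_append, ih (fun i => n i.castSucc),
      List.ofFn_succ', List.concat_eq_append, List.prod_append, List.prod_singleton]
    congr 3
    · funext i
      congr 2
      funext j
      congr 1
      ext
      simp [finSigmaFinEquiv_apply]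
    · funext j
      congr 1
      ext
      simp [finSigmaFinEquiv_apply]
      rfl

namespace Pairing

/-- The multilinear form `v ↦ ∏ K (v l) (v m)`, the product being over the pairs `{l, m}` of a
pairing. -/
def form {N : ℕ} (π : Pairing N) {V : Type*} [AddCommGroup V] [Module ℂ V]
    (K : V →ₗ[ℂ] V →ₗ[ℂ] ℂ) : MultilinearMap ℂ (fun _ : Fin N => V) ℂ where
  toFun v := ∏ x : π.Left, K (v x.1) (v (π.1 x.1))
  map_update_add' := by
    intro inst v i y z
    have hne : ∀ x ∈ Finset.univ.erase (π.left i), x.1 ≠ i ∧ π.1 x.1 ≠ i := by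
      intro x hx
      refine ⟨?_, ?_⟩ <;> rintro rfl
      · exact Finset.ne_of_mem_erase hx (π.left_coe x).symm
      · exact Finset.ne_of_mem_erase hx (π.left_apply_coe x).symm
    -- Coordinate `i` occurs only in the factor of its own pair, and there once, as the left or the
    -- right end.
    simp only [← Finset.mul_prod_erase _ _ (Finset.mem_univ (π.left i))]
    have hrest : ∀ w, ∏ x ∈ Finset.univ.erase (π.left i), K (Function.update v i w x.1)
        (Function.update v i w (π.1 x.1)) =
          ∏ x ∈ Finset.univ.erase (π.left i), K (v x.1) (v (π.1 x.1)) := fun w =>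
      Finset.prod_congr rfl fun x hx => by
        rw [Function.update_of_ne (hne x hx).1, Function.update_of_ne (hne x hx).2]
    rw [hrest, hrest, hrest, ← add_mul]
    congr 1
    obtain h | h := (π.left_eq_iff i _).1 rfl
    · have h' : π.1 (π.left i).1 ≠ i := fun e => π.apply_ne (π.left i).1 (e.trans h)
      rw [← h, Function.update_self, Function.update_self, Function.update_self]
      rw [← h] at h'
      simp [Function.update_of_ne h']
    · have h' : (π.left i).1 ≠ i := fun e => π.apply_ne (π.left i).1 (h.symm.trans e.symm)
      rw [← h, Function.update_self, Function.update_self, Function.update_self]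
      simp [Function.update_of_ne h']
  map_update_smul' := by
    intro inst v i c y
    have hne : ∀ x ∈ Finset.univ.erase (π.left i), x.1 ≠ i ∧ π.1 x.1 ≠ i := by
      intro x hx
      refine ⟨?_, ?_⟩ <;> rintro rfl
      · exact Finset.ne_of_mem_erase hx (π.left_coe x).symm
      · exact Finset.ne_of_mem_erase hx (π.left_apply_coe x).symm
    simp only [← Finset.mul_prod_erase _ _ (Finset.mem_univ (π.left i))]
    have hrest : ∀ w, ∏ x ∈ Finset.univ.erase (π.left i), K (Function.update v i w x.1)
        (Function.update v i w (π.1 x.1)) =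
          ∏ x ∈ Finset.univ.erase (π.left i), K (v x.1) (v (π.1 x.1)) := fun w =>
      Finset.prod_congr rfl fun x hx => by
        rw [Function.update_of_ne (hne x hx).1, Function.update_of_ne (hne x hx).2]
    rw [hrest, hrest, ← smul_mul_assoc]
    congr 1
    obtain h | h := (π.left_eq_iff i _).1 rfl
    · have h' : π.1 (π.left i).1 ≠ i := fun e => π.apply_ne (π.left i).1 (e.trans h)
      rw [← h, Function.update_self, Function.update_self]
      rw [← h] at h'
      simp [Function.update_of_ne h']
    · have h' : (π.left i).1 ≠ i := fun e => π.apply_ne (π.left i).1 (h.symm.trans e.symm)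
      rw [← h, Function.update_self, Function.update_self]
      simp [Function.update_of_ne h']

end Pairing

/-- The bilinear extension of the covariance `(s, t) ↦ min s t` of Brownian motion to formal linear
combinations of times. -/
def brownianCovariance : (ℝ≥0 →₀ ℂ) →ₗ[ℂ] (ℝ≥0 →₀ ℂ) →ₗ[ℂ] ℂ :=
  Finsupp.linearCombination ℂ fun s =>
    Finsupp.linearCombination ℂ fun t => ((min s t : ℝ≥0) : ℂ)

theorem Real.min_sub_min_add_min {a b c d : ℝ} (hab : a ≤ b) (hcd : c ≤ d) :
    min b d - min b c - (min a d - min a c) = max (min b d - max a c) 0 := by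
  grind

/-- The mixed second difference of `min` is the length of the overlap of the two intervals, which is
the `L²` pairing of their indicators. -/
theorem brownianCovariance_increment {a b c d : ℝ≥0} (hab : a < b) (hcd : c < d) :
    brownianCovariance (Finsupp.single b 1 - Finsupp.single a 1)
        (Finsupp.single d 1 - Finsupp.single c 1) =
      ∫ x in Set.Ici (0 : ℝ), (Set.Ioo (a : ℝ) b).indicator (fun _ => (1 : ℂ)) x *
        (Set.Ioo (c : ℝ) d).indicator (fun _ => (1 : ℂ)) x := by
  have h1 : (fun x => (Set.Ioo (a : ℝ) b).indicator (fun _ => (1 : ℂ)) x *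
      (Set.Ioo (c : ℝ) d).indicator (fun _ => (1 : ℂ)) x) =
      (Set.Ioo (max (a : ℝ) c) (min (b : ℝ) d)).indicator fun _ => (1 : ℂ) := by
    rw [← Set.Ioo_inter_Ioo]
    funext x
    rw [← Set.inter_indicator_mul]
    simp
  have h2 : Set.Ioo (max (a : ℝ) c) (min (b : ℝ) d) ∩ Set.Ici 0 =
      Set.Ioo (max (a : ℝ) c) (min (b : ℝ) d) := by
    refine Set.inter_eq_left.mpr fun x hx => ?_
    exact a.2.trans ((le_max_left _ _).trans hx.1.le)
  rw [h1, integral_indicator_const _ measurableSet_Ioo, Measure.real,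
    Measure.restrict_apply measurableSet_Ioo, h2, Real.volume_Ioo, ENNReal.toReal_ofReal',
    ← Real.min_sub_min_add_min (NNReal.coe_le_coe.2 hab.le) (NNReal.coe_le_coe.2 hcd.le)]
  simp [brownianCovariance]

namespace IsQBrownianMotion

variable {H : Type*} [NormedAddCommGroup H] [InnerProductSpace ℂ H] [CompleteSpace H]
  {P : WStarProbabilitySpace H} {q : ℝ} {X : ℝ≥0 → P.Carrier}

theorem trace_prod (hX : IsQBrownianMotion P q X) {N : ℕ} (t : Fin N → ℝ≥0) :
    P.trace (List.ofFn fun i => X (t i)).prod =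
      ∑ π : Pairing N, (q : ℂ) ^ π.crossings *
        ∏ l : π.Left, ((min (t l.1) (t (π.1 l.1)) : ℝ≥0) : ℂ) := by
  rcases Nat.eq_zero_or_pos N with rfl | hN
  -- `joint_moments` omits the empty product. Here the empty pairing is the only one and both sides
  -- are 1; this covers `r = 0` and the zeroth moment in the norm bound.
  · have : Unique (Pairing 0) :=
      ⟨⟨⟨1, fun l => l.elim0⟩⟩, fun π => Subtype.ext (Subsingleton.elim _ _)⟩
    simp [P.trace_one, Pairing.crossings]
  · exact hX.joint_moments N hN t

/-- Both sides are multilinear in `v`, so it suffices to compare them on single times. -/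
theorem trace_prod_linearCombination (hX : IsQBrownianMotion P q X) {N : ℕ}
    (v : Fin N → ℝ≥0 →₀ ℂ) :
    P.trace (List.ofFn fun i => Finsupp.linearCombination ℂ X (v i)).prod =
      ∑ π : Pairing N, (q : ℂ) ^ π.crossings * π.form brownianCovariance v := by
  have key : P.trace.compMultilinearMap ((MultilinearMap.mkPiAlgebraFin ℂ N P.Carrier).compLinearMap
      fun _ => Finsupp.linearCombination ℂ X) =
      ∑ π : Pairing N, (q : ℂ) ^ π.crossings • π.form brownianCovariance := by
    refine Module.Basis.ext_multilinear (fun _ => Finsupp.basisSingleOne) fun t => ?_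
    simpa [Pairing.form, brownianCovariance, sum_apply] using hX.trace_prod t
  simpa [sum_apply] using DFunLike.congr_fun key v

theorem trace_prod_increment (hX : IsQBrownianMotion P q X) {N : ℕ} {a b : Fin N → ℝ≥0}
    (hab : ∀ l, a l < b l) :
    P.trace (List.ofFn fun l => X (b l) - X (a l)).prod =
      ∑ π : Pairing N, (q : ℂ) ^ π.crossings * ∏ l : π.Left, ∫ x in Set.Ici (0 : ℝ),
        (Set.Ioo (a l.1 : ℝ) (b l.1)).indicator (fun _ => (1 : ℂ)) x *
        (Set.Ioo (a (π.1 l.1) : ℝ) (b (π.1 l.1))).indicator (fun _ => (1 : ℂ)) x := by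
  have := hX.trace_prod_linearCombination fun l => Finsupp.single (b l) 1 - Finsupp.single (a l) 1
  simp only [map_sub, Finsupp.linearCombination_single, one_smul] at this
  rw [this]
  refine Finset.sum_congr rfl fun π _ => congrArg _ ?_
  change ∏ l : π.Left, brownianCovariance _ _ = _
  exact Finset.prod_congr rfl fun l _ => brownianCovariance_increment (hab _) (hab _)

end IsQBrownianMotion

theorem OffDiagonalBox.disjoint_real {n : ℕ} (B : OffDiagonalBox n) {i j : Fin n} (h : i ≠ j) :
    Disjoint (Set.Ioo (B.a i : ℝ) (B.b i)) (Set.Ioo (B.a j : ℝ) (B.b j)) := by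
  rw [Set.disjoint_left]
  intro x hi hj
  lift x to ℝ≥0 using (B.a i).2.trans hi.1.le
  simp only [Set.mem_Ioo, NNReal.coe_lt_coe] at hi hj
  exact Set.disjoint_left.mp (B.disjoint h) hi hj

namespace Pairing

variable {r : ℕ} {n : Fin r → ℕ} (π : Pairing (∑ i, n i)) (B : ∀ i, OffDiagonalBox (n i))

/-- The indicator of the side of a family of boxes that belongs to a given position. -/
def sideIndicator (s : Σ i, Fin (n i)) : ℝ → ℂ :=
  (Set.Ioo ((B s.1).a s.2 : ℝ) ((B s.1).b s.2)).indicator fun _ => 1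

/-- The indicator of the side of a family of boxes that belongs to the position `l` after
concatenation. -/
def sideIndicatorAt (l : Fin (∑ i, n i)) : ℝ → ℂ := sideIndicator B (finSigmaFinEquiv.symm l)

theorem sideIndicatorAt_finSigmaFinEquiv (i : Fin r) (j : Fin (n i)) :
    sideIndicatorAt B (finSigmaFinEquiv ⟨i, j⟩) =
      (Set.Ioo ((B i).a j : ℝ) ((B i).b j)).indicator fun _ => 1 := by
  unfold sideIndicatorAt
  rw [Equiv.symm_apply_apply]
  rfl

/-- Grouped by pairs, the indicators form a product of functions of one variable each, and Fubini
applies. -/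
theorem integral_boxes : π.integral (fun i => (B i).indicator) =
    ∏ l : π.Left, ∫ x in Set.Ici (0 : ℝ),
      sideIndicatorAt B l.1 x * sideIndicatorAt B (π.1 l.1) x := by
  unfold integral halfLebesgue
  rw [← integral_fintype_prod_eq_prod]
  refine congrArg _ (funext fun t => ?_)
  have := π.prod_eq_prod_left fun l => sideIndicatorAt B l (t (π.left l))
  simp only [left_coe, left_apply_coe] at this
  rw [← this, ← finSigmaFinEquiv.prod_comp, Fintype.prod_sigma]
  simp [integrand, OffDiagonalBox.indicator, sideIndicatorAt_finSigmaFinEquiv]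

/-- A pair inside one block multiplies indicators of two disjoint sides of the same box. Vanishing
on diagonals thus cuts the sum over all pairings down to the respecting ones. -/
theorem prod_boxes_eq_zero (hπ : ¬ π.Respects) : ∏ l : π.Left, ∫ x in Set.Ici (0 : ℝ),
    sideIndicatorAt B l.1 x * sideIndicatorAt B (π.1 l.1) x = 0 := by
  simp only [Respects, not_forall, not_not] at hπ
  obtain ⟨l, hl⟩ := hπ
  have hzero : ∀ l m : Fin (∑ i, n i), blockIndex l = blockIndex m → l ≠ m →
      ∀ x, sideIndicatorAt B l x * sideIndicatorAt B m x = 0 := by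
    intro l m h hne x
    obtain ⟨⟨i, j⟩, rfl⟩ := finSigmaFinEquiv.surjective l
    obtain ⟨⟨i', j'⟩, rfl⟩ := finSigmaFinEquiv.surjective m
    simp only [blockIndex, Equiv.symm_apply_apply] at h
    subst h
    have hj : j ≠ j' := fun e => hne (by rw [e])
    rw [sideIndicatorAt_finSigmaFinEquiv, sideIndicatorAt_finSigmaFinEquiv,
      ← Set.inter_indicator_mul, ((B i).disjoint_real hj).inter_eq]
    simp
  refine Finset.prod_eq_zero (Finset.mem_univ (π.left l)) ?_
  have h' : ∀ x, sideIndicatorAt B (π.left l).1 x * sideIndicatorAt B (π.1 (π.left l).1) x = 0 := by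
    refine hzero _ _ ?_ (π.apply_ne _).symm
    rcases (π.left_eq_iff l _).1 rfl with h | h
    · rw [← h, hl]
    · have h2 : π.1 l = (π.left l).1 := by conv_lhs => rw [h, π.apply_apply]
      rw [← h2, ← hl, h2, ← h]
  simp [h']

end Pairing

theorem IsQBrownianMotion.trace_prod_boxes {H : Type*} [NormedAddCommGroup H]
    [InnerProductSpace ℂ H] [CompleteSpace H] {P : WStarProbabilitySpace H} {q : ℝ}
    {X : ℝ≥0 → P.Carrier} (hX : IsQBrownianMotion P q X) {r : ℕ} {n : Fin r → ℕ}
    (B : ∀ i, OffDiagonalBox (n i)) :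
    P.trace (List.ofFn fun i => (B i).increment X).prod =
      ∑ π : Pairing (∑ i, n i) with π.Respects,
        (q : ℂ) ^ π.crossings * π.integral fun i => (B i).indicator := by
  let a : (Σ i, Fin (n i)) → ℝ≥0 := fun s => (B s.1).a s.2
  let b : (Σ i, Fin (n i)) → ℝ≥0 := fun s => (B s.1).b s.2
  have h1 : (List.ofFn fun i => (B i).increment X).prod = (List.ofFn fun l : Fin (∑ i, n i) =>
      X (b (finSigmaFinEquiv.symm l)) - X (a (finSigmaFinEquiv.symm l))).prod := by
    rw [List.prod_ofFn_finSigmaFinEquiv]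
    simp only [Equiv.symm_apply_apply]
    rfl
  rw [h1, hX.trace_prod_increment fun l => (B _).lt _, Finset.sum_filter]
  refine Finset.sum_congr rfl fun π _ => ?_
  split_ifs with hπ
  · rw [π.integral_boxes B]
    rfl
  · exact mul_eq_zero_of_right _ (π.prod_boxes_eq_zero B hπ)

/-! ### Density of simple integrands in `L²`. -/

namespace OffDiagonalBox

variable {n : ℕ} (B : OffDiagonalBox n)

theorem indicator_eq : B.indicator =
    (Set.univ.pi fun i => Set.Ioo (B.a i : ℝ) (B.b i)).indicator fun _ => (1 : ℂ) := by
  funext t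
  unfold indicator
  by_cases h : t ∈ Set.univ.pi fun i => Set.Ioo (B.a i : ℝ) (B.b i)
  · rw [Set.indicator_of_mem h]
    exact Finset.prod_eq_one fun i _ => Set.indicator_of_mem (h i (Set.mem_univ i)) _
  · rw [Set.indicator_of_notMem h]
    simp only [Set.mem_univ_pi, not_forall] at h
    obtain ⟨i, hi⟩ := h
    exact Finset.prod_eq_zero (Finset.mem_univ i) (Set.indicator_of_notMem hi _)

theorem indicator_of_mem {t : Fin n → ℝ} (h : ∀ i, t i ∈ Set.Ioo (B.a i : ℝ) (B.b i)) :
    B.indicator t = 1 := by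
  rw [indicator_eq, Set.indicator_of_mem (Set.mem_univ_pi.2 h)]

theorem indicator_of_notMem {t : Fin n → ℝ} (h : ¬ ∀ i, t i ∈ Set.Ioo (B.a i : ℝ) (B.b i)) :
    B.indicator t = 0 := by
  rw [indicator_eq, Set.indicator_of_notMem (by simpa [Set.mem_univ_pi] using h)]

theorem memLp_indicator : MemLp B.indicator 2 (halfLebesgue (Fin n)) := by
  rw [indicator_eq]
  refine memLp_indicator_const 2 (MeasurableSet.univ_pi fun i => measurableSet_Ioo) 1 (Or.inr ?_)
  rw [halfLebesgue, Measure.pi_pi]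
  refine (ENNReal.prod_lt_top fun i _ => ?_).ne
  exact (Measure.restrict_apply_le _ _).trans_lt measure_Ioo_lt_top

end OffDiagonalBox

namespace SimpleIntegrand

variable {n : ℕ}

theorem toFun_add (s s' : SimpleIntegrand n) : (s + s').toFun = s.toFun + s'.toFun :=
  funext fun t => Finsupp.sum_add_index' (by simp) (by intros; ring)

theorem toFun_single (B : OffDiagonalBox n) (c : ℂ) :
    toFun (Finsupp.single B c) = c • B.indicator :=
  funext fun t => Finsupp.sum_single_index (by simp)

theorem toFun_zero : toFun (0 : SimpleIntegrand n) = 0 := rfl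

theorem toFun_sum {ι : Type*} (S : Finset ι) (s : ι → SimpleIntegrand n) (t : Fin n → ℝ) :
    toFun (∑ i ∈ S, s i) t = ∑ i ∈ S, (s i).toFun t := by
  classical
  induction S using Finset.induction with
  | empty => simp [toFun_zero]
  | insert i S hi ih => rw [Finset.sum_insert hi, Finset.sum_insert hi, toFun_add, Pi.add_apply, ih]

theorem memLp_toFun (s : SimpleIntegrand n) : MemLp s.toFun 2 (halfLebesgue (Fin n)) := by
  induction s using Finsupp.induction_linear with
  | zero => exact MemLp.zero
  | add s s' h h' => rw [toFun_add]; exact h.add h'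
  | single B c => rw [toFun_single]; exact B.memLp_indicator.const_smul c

/-- The class in `L²` of a simple integrand. -/
def toLp : SimpleIntegrand n →ₗ[ℂ] Lp ℂ 2 (halfLebesgue (Fin n)) :=
  Finsupp.linearCombination ℂ fun B => B.memLp_indicator.toLp _

theorem toLp_eq (s : SimpleIntegrand n) : toLp s = s.memLp_toFun.toLp := by
  induction s using Finsupp.induction_linear with
  | zero => rw [map_zero]; rfl
  | add s s' h h' =>
    rw [map_add, h, h', ← MemLp.toLp_add]
    exact MemLp.toLp_congr _ _ (by rw [toFun_add])
  | single B c =>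
    rw [toLp, Finsupp.linearCombination_single, ← MemLp.toLp_const_smul]
    exact MemLp.toLp_congr _ _ (by rw [toFun_single])

theorem coeFn_toLp (s : SimpleIntegrand n) : toLp s =ᵐ[halfLebesgue (Fin n)] s.toFun := by
  rw [toLp_eq]; exact MemLp.coeFn_toLp _

end SimpleIntegrand

section Grid

variable {n : ℕ}

/-- A cell of the grid of mesh `1 / (k + 1)` that does not meet the diagonals. -/
def gridBox (k : ℕ) (m : Fin n ↪ Fin ((k + 1) * (k + 1))) : OffDiagonalBox n where
  -- With `(k + 1) * (k + 1)` cells of width `1 / (k + 1)` per axis, the grid reaches up to `k + 1`: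
  -- range and resolution grow together. Injectivity of `m` excludes the diagonal cells.
  a i := (m i : ℝ≥0) / (k + 1)
  b i := ((m i : ℝ≥0) + 1) / (k + 1)
  lt i := by
    have : (0 : ℝ≥0) < k + 1 := by positivity
    gcongr
    exact lt_add_one _
  disjoint i j hij := by
    have hk : (0 : ℝ≥0) < k + 1 := by positivity
    change Disjoint _ _
    rw [Set.disjoint_left]
    rintro x ⟨h1, h2⟩ ⟨h3, h4⟩
    have h5 := (div_lt_div_iff_of_pos_right hk).1 (h1.trans h4)
    have h6 := (div_lt_div_iff_of_pos_right hk).1 (h3.trans h2)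
    norm_cast at h5 h6
    exact hij (m.injective (Fin.ext (by omega)))

theorem mem_gridBox_iff (k : ℕ) (m : Fin n ↪ Fin ((k + 1) * (k + 1))) (t : Fin n → ℝ) (i : Fin n) :
    t i ∈ Set.Ioo ((gridBox k m).a i : ℝ) ((gridBox k m).b i) ↔
      (m i : ℝ) < (k + 1) * t i ∧ (k + 1) * t i < m i + 1 := by
  have hk : (0 : ℝ) < k + 1 := by positivity
  simp only [gridBox, NNReal.coe_div, NNReal.coe_add, NNReal.coe_natCast, NNReal.coe_one,
    Set.mem_Ioo]
  rw [div_lt_iff₀' hk, lt_div_iff₀' hk]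

/-- The step function with the values of `g` at the lower left corners of the grid cells. -/
def gridSum (g : (Fin n → ℝ) → ℂ) (k : ℕ) : SimpleIntegrand n :=
  ∑ m : Fin n ↪ Fin ((k + 1) * (k + 1)), Finsupp.single (gridBox k m) (g fun i => m i / (k + 1))

theorem gridSum_apply (g : (Fin n → ℝ) → ℂ) (k : ℕ) (t : Fin n → ℝ) :
    (gridSum g k).toFun t = ∑ m : Fin n ↪ Fin ((k + 1) * (k + 1)),
      (g fun i => m i / (k + 1)) * (gridBox k m).indicator t := by
  simp [gridSum, SimpleIntegrand.toFun_sum, SimpleIntegrand.toFun_single]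

theorem gridSum_eq_of_mem (g : (Fin n → ℝ) → ℂ) {k : ℕ} {m : Fin n ↪ Fin ((k + 1) * (k + 1))}
    {t : Fin n → ℝ}
    (h : ∀ i, t i ∈ Set.Ioo ((gridBox k m).a i : ℝ) ((gridBox k m).b i)) :
    ∃ c, dist c t ≤ 1 / ((k : ℝ) + 1) ∧ (gridSum g k).toFun t = g c := by
  have hk : (0 : ℝ) < k + 1 := by positivity
  refine ⟨fun i => m i / (k + 1), ?_, ?_⟩
  · refine (dist_pi_le_iff (by positivity)).2 fun i => ?_
    have := (mem_gridBox_iff k m t i).1 (h i)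
    rw [Real.dist_eq, abs_le]
    constructor
    · rw [neg_le_sub_iff_le_add, ← add_div, le_div_iff₀' hk]; exact this.2.le
    · have e : (t i + 1 / ((k : ℝ) + 1)) * (k + 1) = (k + 1) * t i + 1 := by field_simp
      rw [tsub_le_iff_left, div_le_iff₀ hk, e]
      linarith [this.1]
  · rw [gridSum_apply, Finset.sum_eq_single m, OffDiagonalBox.indicator_of_mem _ h, mul_one]
    · intro m' _ hne
      rw [OffDiagonalBox.indicator_of_notMem, mul_zero]
      intro h'
      refine hne (DFunLike.ext _ _ fun i => Fin.ext ?_)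
      have h1 := (mem_gridBox_iff k m t i).1 (h i)
      have h2 := (mem_gridBox_iff k m' t i).1 (h' i)
      have h3 := h1.1.trans h2.2
      have h4 := h2.1.trans h1.2
      norm_cast at h3 h4
      omega
    · simp

theorem gridSum_eq_zero_or (g : (Fin n → ℝ) → ℂ) (k : ℕ) (t : Fin n → ℝ) :
    (gridSum g k).toFun t = 0 ∨
      ∃ c, dist c t ≤ 1 / ((k : ℝ) + 1) ∧ (gridSum g k).toFun t = g c := by
  by_cases h : ∃ m : Fin n ↪ Fin ((k + 1) * (k + 1)),
      ∀ i, t i ∈ Set.Ioo ((gridBox k m).a i : ℝ) ((gridBox k m).b i)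
  · obtain ⟨m, hm⟩ := h
    exact .inr (gridSum_eq_of_mem g hm)
  · push Not at h
    left
    rw [gridSum_apply]
    refine Finset.sum_eq_zero fun m _ => ?_
    rw [OffDiagonalBox.indicator_of_notMem _ (by simpa using h m), mul_zero]

/-- Irrational coordinates never lie on a cell boundary, and distinct coordinates fall into
different cells once the mesh is below their distance. Almost every point of the orthant has these
properties. -/
theorem eventually_gridSum_eq (g : (Fin n → ℝ) → ℂ) {t : Fin n → ℝ} (h0 : ∀ i, 0 ≤ t i)
    (hirr : ∀ i, Irrational (t i)) (hinj : Function.Injective t) :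
    ∀ᶠ k : ℕ in atTop, ∃ c, dist c t ≤ 1 / ((k : ℝ) + 1) ∧ (gridSum g k).toFun t = g c := by
  have h1 : ∀ᶠ k : ℕ in atTop, ∀ i, t i < k + 1 := by
    rw [eventually_all]
    intro i
    filter_upwards [eventually_ge_atTop ⌈t i⌉₊] with k hk
    exact (Nat.ceil_le.1 hk).trans_lt (lt_add_one _)
  have h2 : ∀ᶠ k : ℕ in atTop, ∀ i j, i ≠ j → 1 < ((k : ℝ) + 1) * |t i - t j| := by
    rw [eventually_all]; intro i
    rw [eventually_all]; intro j
    by_cases hij : i = j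
    · simp [hij]
    have hpos : 0 < |t i - t j| := abs_pos.2 (sub_ne_zero.2 fun e => hij (hinj e))
    have : Tendsto (fun k : ℕ => ((k : ℝ) + 1) * |t i - t j|) atTop atTop :=
      (tendsto_atTop_add_const_right _ _ tendsto_natCast_atTop_atTop).atTop_mul_const hpos
    filter_upwards [this.eventually_gt_atTop 1] with k hk _ using hk
  filter_upwards [h1, h2] with k hk1 hk2
  have hk : (0 : ℝ) < k + 1 := by positivity
  have hnn : ∀ i, 0 ≤ ((k : ℝ) + 1) * t i := fun i => mul_nonneg hk.le (h0 i)
  have hlt : ∀ i, ⌊((k : ℝ) + 1) * t i⌋₊ < (k + 1) * (k + 1) := by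
    intro i
    rw [Nat.floor_lt (hnn i)]
    push_cast
    exact mul_lt_mul_of_pos_left (hk1 i) hk
  let m : Fin n ↪ Fin ((k + 1) * (k + 1)) :=
    ⟨fun i => ⟨⌊((k : ℝ) + 1) * t i⌋₊, hlt i⟩, fun i j hij => by
      by_contra hne
      have e : ⌊((k : ℝ) + 1) * t i⌋₊ = ⌊((k : ℝ) + 1) * t j⌋₊ := by simpa using hij
      have a1 := Nat.floor_le (hnn i)
      have a2 := Nat.lt_floor_add_one (((k : ℝ) + 1) * t i)
      have b1 := Nat.floor_le (hnn j)
      have b2 := Nat.lt_floor_add_one (((k : ℝ) + 1) * t j)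
      rw [e] at a1 a2
      have := hk2 i j hne
      rw [← abs_of_pos hk, ← abs_mul, lt_abs] at this
      rcases this with h | h <;> linarith⟩
  refine gridSum_eq_of_mem (m := m) g fun i => (mem_gridBox_iff k m t i).2 ⟨?_, ?_⟩
  · refine lt_of_le_of_ne (Nat.floor_le (hnn i)) fun e => ?_
    have h3 : Irrational (((k + 1 : ℕ) : ℝ) * t i) := (hirr i).natCast_mul (Nat.succ_ne_zero k)
    push_cast at h3
    rw [← e] at h3
    exact (Nat.not_irrational _) h3
  · exact Nat.lt_floor_add_one _

end Grid

instance (ι : Type*) [Fintype ι] : IsLocallyFiniteMeasure (halfLebesgue ι) := by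
  unfold halfLebesgue; infer_instance

theorem ae_halfLebesgue_nonneg (ι : Type*) [Fintype ι] :
    ∀ᵐ t ∂halfLebesgue ι, ∀ i, 0 ≤ t i := by
  rw [ae_all_iff]
  intro i
  exact (Measure.quasiMeasurePreserving_eval
    (fun _ : ι => (volume : Measure ℝ).restrict (Set.Ici 0)) i).ae
      (ae_restrict_mem measurableSet_Ici)

theorem ae_halfLebesgue_irrational (ι : Type*) [Fintype ι] :
    ∀ᵐ t ∂halfLebesgue ι, ∀ i, Irrational (t i) := by
  rw [ae_all_iff]
  intro i
  exact (Measure.quasiMeasurePreserving_eval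
    (fun _ : ι => (volume : Measure ℝ).restrict (Set.Ici 0)) i).ae
      (ae_restrict_of_ae ((Set.countable_range _).ae_notMem _))

theorem halfLebesgue_le_volume (ι : Type*) [Fintype ι] : halfLebesgue ι ≤ volume := by
  rw [halfLebesgue, ← Measure.restrict_pi_pi]
  exact Measure.restrict_le_self

theorem ae_halfLebesgue_injective (ι : Type*) [Fintype ι] :
    ∀ᵐ t : ι → ℝ ∂halfLebesgue ι, Function.Injective t := by
  classical
  have : ∀ᵐ t : ι → ℝ ∂halfLebesgue ι, ∀ i j, i ≠ j → t i ≠ t j := by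
    rw [ae_all_iff]; intro i
    rw [ae_all_iff]; intro j
    by_cases hij : i = j
    · simp [hij]
    let p : Submodule ℝ (ι → ℝ) :=
      LinearMap.ker (LinearMap.proj (R := ℝ) (φ := fun _ : ι => ℝ) i - LinearMap.proj j)
    have hp : p ≠ ⊤ := by
      intro h
      have : (Pi.single i 1 : ι → ℝ) ∈ p := h ▸ Submodule.mem_top
      simp [p, Pi.single_eq_of_ne (Ne.symm hij)] at this
    have h0 : volume (p : Set (ι → ℝ)) = 0 := Measure.addHaar_submodule _ p hp
    have h1 : ∀ᵐ t : ι → ℝ, t ∉ (p : Set (ι → ℝ)) := measure_eq_zero_iff_ae_notMem.1 h0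
    filter_upwards [(halfLebesgue_le_volume ι).absolutelyContinuous.ae_le h1] with t ht _ h
    exact ht (by simp [p, h])
  filter_upwards [this] with t ht i j h
  by_contra hne
  exact ht i j hne h

/-- Almost every point eventually lies in an admissible cell whose corner tends to it, so continuity
gives pointwise convergence; compact support allows dominated convergence. -/
theorem tendsto_gridSum {n : ℕ} {g : (Fin n → ℝ) → ℂ} (hg : Continuous g)
    (hgc : HasCompactSupport g) :
    Tendsto (fun k => eLpNorm ((gridSum g k).toFun - g) 2 (halfLebesgue (Fin n))) atTop (𝓝 0) := by
  obtain ⟨C, hC⟩ := hg.bounded_above_of_compact_support hgc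
  have hC0 : 0 ≤ C := (norm_nonneg _).trans (hC 0)
  obtain ⟨R, hR⟩ := hgc.isCompact.isBounded.subset_closedBall 0
  have hout : ∀ t, R < dist t 0 → g t = 0 := fun t ht => by
    by_contra h
    exact absurd (hR (subset_tsupport g h)) (by simpa using ht)
  -- The radius is `R + 1` because a point of a cell is within `1 / (k + 1) ≤ 1` of the corner where
  -- `g` is evaluated.
  have hbound : ∀ k t, ‖(gridSum g k).toFun t - g t‖ₑ ^ (2 : ℝ) ≤
      (Metric.closedBall (0 : Fin n → ℝ) (R + 1)).indicator
        (fun _ => ENNReal.ofReal (C + C) ^ (2 : ℝ)) t := by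
    intro k t
    have h1 : (1 : ℝ) / (k + 1) ≤ 1 := by
      rw [div_le_one (by positivity)]; linarith [(Nat.cast_nonneg k : (0 : ℝ) ≤ k)]
    by_cases ht : t ∈ Metric.closedBall (0 : Fin n → ℝ) (R + 1)
    · rw [Set.indicator_of_mem ht]
      gcongr
      rw [← ofReal_norm]
      refine ENNReal.ofReal_le_ofReal ((norm_sub_le _ _).trans (add_le_add ?_ (hC t)))
      rcases gridSum_eq_zero_or g k t with h | ⟨c, -, h⟩
      · rw [h, norm_zero]; exact hC0
      · rw [h]; exact hC c
    · rw [Set.indicator_of_notMem ht]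
      rw [Metric.mem_closedBall, not_le] at ht
      have h2 : (gridSum g k).toFun t = 0 := by
        rcases gridSum_eq_zero_or g k t with h | ⟨c, hc, h⟩
        · exact h
        · rw [h]
          refine hout c ?_
          have := dist_triangle t c 0
          rw [dist_comm t c] at this
          linarith
      rw [h2, hout t (by linarith)]
      simp
  have hfin : ∫⁻ t, (Metric.closedBall (0 : Fin n → ℝ) (R + 1)).indicator
        (fun _ => ENNReal.ofReal (C + C) ^ (2 : ℝ)) t ∂halfLebesgue (Fin n) ≠ ∞ := by
    rw [lintegral_indicator_const measurableSet_closedBall]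
    refine ENNReal.mul_ne_top (by simp) ?_
    exact (isCompact_closedBall _ _).measure_lt_top.ne
  have hlim := tendsto_lintegral_of_dominated_convergence' (μ := halfLebesgue (Fin n))
    (F := fun k t => ‖(gridSum g k).toFun t - g t‖ₑ ^ (2 : ℝ)) (f := fun _ => 0) _
    (fun k => ?_) (fun k => Eventually.of_forall (hbound k)) hfin ?_
  · have h3 : ∀ k, eLpNorm ((gridSum g k).toFun - g) 2 (halfLebesgue (Fin n)) =
        (∫⁻ t, ‖(gridSum g k).toFun t - g t‖ₑ ^ (2 : ℝ) ∂halfLebesgue (Fin n)) ^ (1 / 2 : ℝ) := by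
      intro k
      rw [eLpNorm_eq_lintegral_rpow_enorm_toReal two_ne_zero ENNReal.ofNat_ne_top]
      simp
    simp only [h3]
    rw [lintegral_zero] at hlim
    have := hlim.ennrpow_const (1 / 2 : ℝ)
    rwa [ENNReal.zero_rpow_of_pos (by norm_num)] at this
  · exact (((gridSum g k).memLp_toFun.1.sub hg.aestronglyMeasurable).enorm).pow_const _
  · filter_upwards [ae_halfLebesgue_nonneg _, ae_halfLebesgue_irrational _,
      ae_halfLebesgue_injective _] with t h0 hirr hinj
    have h4 : Tendsto (fun k => (gridSum g k).toFun t) atTop (𝓝 (g t)) := by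
      rw [Metric.tendsto_atTop']
      intro ε hε
      obtain ⟨δ, hδ, hgδ⟩ := Metric.continuousAt_iff.1 (hg.continuousAt (x := t)) ε hε
      have h5 : ∀ᶠ k : ℕ in atTop, 1 / ((k : ℝ) + 1) < δ :=
        tendsto_one_div_add_atTop_nhds_zero_nat.eventually_lt_const hδ
      obtain ⟨N, hN⟩ := ((eventually_gridSum_eq g h0 hirr hinj).and h5).exists_forall_of_atTop
      refine ⟨N, fun k hk => ?_⟩
      obtain ⟨⟨c, hc, h⟩, h6⟩ := hN k hk.le
      rw [h]
      exact hgδ (hc.trans_lt h6)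
    have h7 : Tendsto (fun k => ‖(gridSum g k).toFun t - g t‖ₑ ^ (2 : ℝ)) atTop
        (𝓝 (‖g t - g t‖ₑ ^ (2 : ℝ))) := ((h4.sub_const _).enorm).ennrpow_const _
    simpa using h7

/-- Simple integrands are dense in `L²`. -/
theorem SimpleIntegrand.denseRange_toLp {n : ℕ} :
    DenseRange (SimpleIntegrand.toLp : SimpleIntegrand n → Lp ℂ 2 (halfLebesgue (Fin n))) := by
  intro f
  rw [EMetric.mem_closure_iff]
  intro ε hε
  rcases eq_or_ne ε ∞ with rfl | hε'
  · exact ⟨_, ⟨0, rfl⟩, edist_lt_top _ _⟩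
  -- Two errors of a quarter each leave room for a strict inequality, although `hfg` is not strict.
  have hε4 : ε / 2 / 2 ≠ 0 := by simp [hε.ne']
  obtain ⟨g, hgc, hfg, hg, hgL⟩ := (Lp.memLp f).exists_hasCompactSupport_eLpNorm_sub_le
    ENNReal.ofNat_ne_top hε4
  obtain ⟨k, hk⟩ := ((tendsto_gridSum hg hgc).eventually_lt_const (pos_iff_ne_zero.2 hε4)).exists
  refine ⟨_, ⟨gridSum g k, rfl⟩, ?_⟩
  have e : eLpNorm (⇑f - ⇑(SimpleIntegrand.toLp (gridSum g k))) 2 (halfLebesgue (Fin n)) =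
      eLpNorm ((⇑f - g) - ((gridSum g k).toFun - g)) 2 (halfLebesgue (Fin n)) := by
    refine eLpNorm_congr_ae ?_
    filter_upwards [SimpleIntegrand.coeFn_toLp (gridSum g k)] with t ht
    simp [ht]
  rw [Lp.edist_def, e]
  calc _ ≤ eLpNorm (⇑f - g) 2 (halfLebesgue (Fin n)) +
        eLpNorm ((gridSum g k).toFun - g) 2 (halfLebesgue (Fin n)) :=
        eLpNorm_sub_le ((Lp.memLp f).1.sub hgL.1) ((gridSum g k).memLp_toFun.1.sub hgL.1)
          (by norm_num)
    _ ≤ ε / 2 / 2 + ε / 2 / 2 := add_le_add hfg hk.le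
    _ < ε := by
      rw [ENNReal.add_halves]
      exact ENNReal.half_lt_self hε.ne' hε'

/-! ### Adjoints and the operator norm bound. -/

theorem List.star_prod_ofFn {M : Type*} [Monoid M] [StarMul M] {n : ℕ} (g : Fin n → M) :
    star (List.ofFn g).prod = (List.ofFn fun i => star (g i.rev)).prod := by
  induction n with
  | zero => simp
  | succ n ih =>
    rw [List.ofFn_succ, List.prod_cons, star_mul, ih, List.ofFn_succ', List.concat_eq_append,
      List.prod_append, List.prod_singleton]
    simp [Fin.rev_castSucc]

theorem List.prod_ofFn_alternating {M : Type*} [Monoid M] (a b : M) (m : ℕ) :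
    (List.ofFn fun i : Fin (2 * m) => if i.1 % 2 = 0 then a else b).prod = (a * b) ^ m := by
  induction m with
  | zero => simp
  | succ m ih =>
    change (List.ofFn fun i : Fin (2 * m + 1 + 1) => if i.1 % 2 = 0 then a else b).prod = _
    rw [List.ofFn_succ, List.ofFn_succ]
    simp [Nat.add_mod_right, add_assoc, ih, pow_succ', mul_assoc]

theorem measurePreserving_comp_rev (n : ℕ) :
    MeasurePreserving (fun t : Fin n → ℝ => t ∘ Fin.rev) (halfLebesgue (Fin n))
      (halfLebesgue (Fin n)) := by
  have h := measurePreserving_piCongrLeft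
    (fun _ : Fin n => (volume : Measure ℝ).restrict (Set.Ici 0)) Fin.revPerm
  unfold halfLebesgue
  convert h using 1
  funext t i
  obtain ⟨l, rfl⟩ := Fin.revPerm.surjective i
  refine Eq.trans ?_ (Equiv.piCongrLeft_apply_apply (fun _ : Fin n => ℝ) Fin.revPerm t l).symm
  simp

namespace OffDiagonalBox

variable {n : ℕ}

/-- The box with the sides in reverse order. -/
def reverse (B : OffDiagonalBox n) : OffDiagonalBox n where
  a i := B.a i.rev
  b i := B.b i.rev
  lt i := B.lt i.rev
  disjoint _ _ h := B.disjoint (Fin.rev_injective.ne h)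

theorem indicator_reverse (B : OffDiagonalBox n) (t : Fin n → ℝ) :
    B.reverse.indicator t = B.indicator (t ∘ Fin.rev) := by
  unfold indicator
  rw [← Equiv.prod_comp Fin.revPerm]
  simp [reverse]

theorem star_indicator (B : OffDiagonalBox n) (t : Fin n → ℝ) :
    star (B.indicator t) = B.indicator t := by
  rw [indicator_eq]
  by_cases h : t ∈ Set.univ.pi fun i => Set.Ioo (B.a i : ℝ) (B.b i)
  · simp [Set.indicator_of_mem h]
  · simp [Set.indicator_of_notMem h]

end OffDiagonalBox

namespace SimpleIntegrand

variable {n : ℕ}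

/-- The adjoint simple integrand `t ↦ conj (s (tₙ, …, t₁))`. -/
def adjoint (s : SimpleIntegrand n) : SimpleIntegrand n :=
  s.sum fun B c => Finsupp.single B.reverse (star c)

theorem adjoint_add (s s' : SimpleIntegrand n) : (s + s').adjoint = s.adjoint + s'.adjoint :=
  Finsupp.sum_add_index' (by simp) (by intros; rw [star_add, Finsupp.single_add])

theorem adjoint_single (B : OffDiagonalBox n) (c : ℂ) :
    adjoint (Finsupp.single B c) = Finsupp.single B.reverse (star c) :=
  Finsupp.sum_single_index (by simp)

theorem adjoint_zero : adjoint (0 : SimpleIntegrand n) = 0 := rfl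

theorem toFun_adjoint (s : SimpleIntegrand n) (t : Fin n → ℝ) :
    s.adjoint.toFun t = star (s.toFun (t ∘ Fin.rev)) := by
  induction s using Finsupp.induction_linear with
  | zero => simp [adjoint_zero, toFun_zero]
  | add s s' h h' =>
    rw [adjoint_add, toFun_add, toFun_add, Pi.add_apply, Pi.add_apply, h, h', star_add]
  | single B c =>
    rw [adjoint_single, toFun_single, toFun_single, Pi.smul_apply, Pi.smul_apply, smul_eq_mul,
      smul_eq_mul, star_mul', B.star_indicator, B.indicator_reverse]

theorem norm_toLp_adjoint (s : SimpleIntegrand n) : ‖toLp s.adjoint‖ = ‖toLp s‖ := by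
  rw [toLp_eq, toLp_eq, Lp.norm_toLp, Lp.norm_toLp]
  congr 1
  rw [← eLpNorm_comp_measurePreserving s.memLp_toFun.1 (measurePreserving_comp_rev n)]
  refine eLpNorm_congr_norm_ae (Eventually.of_forall fun t => ?_)
  rw [toFun_adjoint, norm_star]
  rfl

variable {H : Type*} [NormedAddCommGroup H] [InnerProductSpace ℂ H] [CompleteSpace H]
  {P : WStarProbabilitySpace H} (X : ℝ≥0 → P.Carrier)

/-- The multiple integral of simple integrands as a linear map. -/
def integralLM : SimpleIntegrand n →ₗ[ℂ] P.Carrier :=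
  Finsupp.linearCombination ℂ fun B => B.increment X

theorem integralLM_apply (s : SimpleIntegrand n) : integralLM X s = s.integral X := rfl

variable {X}

/-- Since `star` reverses products, `adjoint` reverses the sides. Hence moments of `star Z * Z` for
a simple integral `Z` are again traces of products of simple integrals. -/
theorem integral_adjoint (hX : ∀ t, IsSelfAdjoint (X t)) (s : SimpleIntegrand n) :
    s.adjoint.integral X = star (s.integral X) := by
  simp only [← integralLM_apply]
  induction s using Finsupp.induction_linear with
  | zero => simp [adjoint_zero]
  | add s s' h h' => rw [adjoint_add, map_add, map_add, h, h', star_add]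
  | single B c =>
    rw [adjoint_single, integralLM, Finsupp.linearCombination_single,
      Finsupp.linearCombination_single, star_smul, OffDiagonalBox.increment,
      OffDiagonalBox.increment, List.star_prod_ofFn]
    simp [OffDiagonalBox.reverse, (hX _).star_eq]

end SimpleIntegrand

/-- The sum of the pairing integrals over all respecting pairings, weighted by `q` to the number of
crossings. -/
def weightedPairingIntegral (q : ℝ) {r : ℕ} (n : Fin r → ℕ) :
    ContinuousMultilinearMap ℂ (fun i => Lp ℂ 2 (halfLebesgue (Fin (n i)))) ℂ :=
  ∑ π : {π : Pairing (∑ i, n i) // π.Respects}, (q : ℂ) ^ π.1.crossings • π.2.integralCLM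

theorem weightedPairingIntegral_apply (q : ℝ) {r : ℕ} {n : Fin r → ℕ}
    (f : ∀ i, Lp ℂ 2 (halfLebesgue (Fin (n i)))) :
    weightedPairingIntegral q n f = ∑ π : Pairing (∑ i, n i) with π.Respects,
      (q : ℂ) ^ π.crossings * π.integral fun i => ⇑(f i) := by
  rw [Finset.sum_subtype (p := Pairing.Respects) (F := inferInstance) _ (by simp)]
  simp [weightedPairingIntegral, sum_apply, Pairing.Respects.integralCLM_apply]

/-- The contraction inequality bounds each term and the crossing count bounds the sum of the
weights. The constant is exponential in the number of variables, where the number of pairings alone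
would be factorial; this is what survives letting the number of factors tend to infinity. -/
theorem norm_weightedPairingIntegral_le {q : ℝ} (hq : |q| < 1) {r : ℕ} {n : Fin r → ℕ}
    (f : ∀ i, Lp ℂ 2 (halfLebesgue (Fin (n i)))) :
    ‖weightedPairingIntegral q n f‖ ≤ (2 * (1 - |q|)⁻¹) ^ (∑ i, n i) * ∏ i, ‖f i‖ := by
  rw [weightedPairingIntegral_apply]
  calc _ ≤ ∑ π : Pairing (∑ i, n i) with π.Respects,
        ‖(q : ℂ) ^ π.crossings * π.integral fun i => ⇑(f i)‖ := norm_sum_le _ _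
    _ ≤ ∑ π : Pairing (∑ i, n i) with π.Respects, |q| ^ π.crossings * ∏ i, ‖f i‖ := by
        refine Finset.sum_le_sum fun π hπ => ?_
        rw [norm_mul, norm_pow, Complex.norm_real, Real.norm_eq_abs]
        gcongr
        exact Pairing.Respects.norm_integral_le (Finset.mem_filter.1 hπ).2 f
    _ ≤ ∑ π : Pairing (∑ i, n i), |q| ^ π.crossings * ∏ i, ‖f i‖ :=
        Finset.sum_le_sum_of_subset_of_nonneg (Finset.filter_subset _ _) fun _ _ _ => by positivity
    _ ≤ _ := by
        rw [← Finset.sum_mul]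
        gcongr
        exact Pairing.sum_pow_crossings_le (abs_nonneg q) hq _

namespace IsQBrownianMotion

variable {H : Type*} [NormedAddCommGroup H] [InnerProductSpace ℂ H] [CompleteSpace H]
  {P : WStarProbabilitySpace H} {q : ℝ} {X : ℝ≥0 → P.Carrier}

/-- By multilinearity, it is enough to treat single boxes. -/
theorem trace_prod_simpleIntegrand (hX : IsQBrownianMotion P q X) {r : ℕ} {n : Fin r → ℕ}
    (s : ∀ i, SimpleIntegrand (n i)) :
    P.trace (List.ofFn fun i => (s i).integral X).prod =
      weightedPairingIntegral q n fun i => (s i).toLp := by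
  have key : P.trace.compMultilinearMap ((MultilinearMap.mkPiAlgebraFin ℂ r P.Carrier).compLinearMap
      fun i => SimpleIntegrand.integralLM (n := n i) X) =
      (weightedPairingIntegral q n).toMultilinearMap.compLinearMap
        fun i => SimpleIntegrand.toLp (n := n i) := by
    refine Module.Basis.ext_multilinear (fun _ => Finsupp.basisSingleOne) fun B => ?_
    have h1 : ∀ i, SimpleIntegrand.toLp (n := n i) (Finsupp.single (B i) 1) =
        (B i).memLp_indicator.toLp _ := fun i => by
      rw [SimpleIntegrand.toLp, Finsupp.linearCombination_single, one_smul]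
    have h2 : ∀ i, SimpleIntegrand.integralLM X (Finsupp.single (B i) 1) = (B i).increment X :=
      fun i => by rw [SimpleIntegrand.integralLM, Finsupp.linearCombination_single, one_smul]
    simp only [LinearMap.compMultilinearMap_apply, MultilinearMap.compLinearMap_apply,
      MultilinearMap.mkPiAlgebraFin_apply, Finsupp.coe_basisSingleOne, h1, h2,
      ContinuousMultilinearMap.coe_coe]
    rw [hX.trace_prod_boxes, weightedPairingIntegral_apply]
    refine Finset.sum_congr rfl fun π hπ => congrArg _ ?_
    exact Pairing.Respects.integral_congr_ae (Finset.mem_filter.1 hπ).2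
      fun i => (MemLp.coeFn_toLp _).symm
  exact DFunLike.congr_fun key s

/-- The multiple integral of a simple integrand is bounded in operator norm by its `L²` norm. -/
theorem norm_integral_simpleIntegrand_le (hX : IsQBrownianMotion P q X) (hq : |q| < 1) {n : ℕ}
    (s : SimpleIntegrand n) :
    ‖s.integral X‖ ≤ (2 * (1 - |q|)⁻¹) ^ n * ‖s.toLp‖ := by
  have hC : 0 ≤ 2 * (1 - |q|)⁻¹ := mul_nonneg two_pos.le (inv_nonneg.2 (sub_nonneg.2 hq.le))
  refine P.norm_le_of_moments _ (by positivity) fun m => ?_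
  -- `(star Z * Z) ^ m` is an alternating product of `2 * m` integrals, all with integrands of the
  -- same norm. With `C = 2 * (1 - |q|)⁻¹` its trace is at most `C ^ (2 * m * n) * ‖s‖ ^ (2 * m)`,
  -- the power needed for the bound `C ^ n * ‖s‖`.
  let w : Fin (2 * m) → SimpleIntegrand n := fun i => if i.1 % 2 = 0 then s.adjoint else s
  have h1 := hX.trace_prod_simpleIntegrand (n := fun _ : Fin (2 * m) => n) w
  have h2 : (fun i => (w i).integral X) =
      fun i : Fin (2 * m) => if i.1 % 2 = 0 then star (s.integral X) else s.integral X := by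
    funext i
    simp only [w]
    split_ifs
    · exact SimpleIntegrand.integral_adjoint hX.isSelfAdjoint s
    · rfl
  have h3 : ∀ i, ‖(w i).toLp‖ = ‖s.toLp‖ := fun i => by
    simp only [w]
    split_ifs
    · exact s.norm_toLp_adjoint
    · rfl
  rw [h2, List.prod_ofFn_alternating] at h1
  rw [h1]
  refine (Complex.re_le_norm _).trans ((norm_weightedPairingIntegral_le hq _).trans_eq ?_)
  simp only [h3, Finset.sum_const, Finset.prod_const, Finset.card_univ, Fintype.card_fin,
    smul_eq_mul]
  rw [← pow_mul, mul_pow (_ ^ n), ← pow_mul, mul_comm n]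

end IsQBrownianMotion

/-! ### Extension to `L²` and the theorem. -/

/-- The multiple integral as a continuous linear map from `L²` to the von Neumann algebra. -/
def multipleIntegral {H : Type*} [NormedAddCommGroup H] [InnerProductSpace ℂ H] [CompleteSpace H]
    {P : WStarProbabilitySpace H} (X : ℝ≥0 → P.Carrier) (n : ℕ) :
    Lp ℂ 2 (halfLebesgue (Fin n)) →L[ℂ] P.Carrier :=
  (SimpleIntegrand.integralLM X).extendOfNorm SimpleIntegrand.toLp

namespace IsQBrownianMotion

variable {H : Type*} [NormedAddCommGroup H] [InnerProductSpace ℂ H] [CompleteSpace H]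
  {P : WStarProbabilitySpace H} {q : ℝ} {X : ℝ≥0 → P.Carrier}

theorem multipleIntegral_toLp (hX : IsQBrownianMotion P q X) (hq : |q| < 1) {n : ℕ}
    (s : SimpleIntegrand n) : multipleIntegral X n s.toLp = s.integral X :=
  LinearMap.extendOfNorm_eq SimpleIntegrand.denseRange_toLp
    ⟨_, hX.norm_integral_simpleIntegrand_le hq⟩ s

theorem tendsto_trace_simpleIntegrand (hX : IsQBrownianMotion P q X) (hq : |q| < 1) {n : ℕ}
    {s : ℕ → SimpleIntegrand n} {f : Lp ℂ 2 (halfLebesgue (Fin n))}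
    (h : Tendsto (fun k => (s k).toLp) atTop (𝓝 f)) :
    Tendsto (fun k => P.trace (star ((s k).integral X - multipleIntegral X n f) *
      ((s k).integral X - multipleIntegral X n f))) atTop (𝓝 0) := by
  have h1 : Tendsto (fun k => (s k).integral X - multipleIntegral X n f) atTop (𝓝 0) := by
    have := ((multipleIntegral X n).continuous.tendsto f).comp h
    simp only [Function.comp_def, hX.multipleIntegral_toLp hq] at this
    simpa using this.sub_const (multipleIntegral X n f)
  have h2 : Continuous fun Z : P.Carrier => P.trace (star Z * Z) :=
    P.continuous_trace.comp (by fun_prop)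
  have h3 := (h2.tendsto 0).comp h1
  rw [star_zero, zero_mul, map_zero] at h3
  exact h3

theorem tendsto_toLp_iff {n : ℕ} (s : ℕ → SimpleIntegrand n) {f : (Fin n → ℝ) → ℂ}
    (hf : MemLp f 2 (halfLebesgue (Fin n))) :
    Tendsto (fun k => (s k).toLp) atTop (𝓝 (hf.toLp f)) ↔
      Tendsto (fun k => eLpNorm (fun t => (s k).toFun t - f t) 2 (halfLebesgue (Fin n)))
        atTop (𝓝 0) := by
  simp only [SimpleIntegrand.toLp_eq]
  exact Lp.tendsto_Lp_iff_tendsto_eLpNorm'' _ (fun k => (s k).memLp_toFun) f hf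

/-- Along any admissible approximating sequence the simple integrals also converge in norm to the
value of the extension, hence in `L²(𝒜, φ)`, where faithfulness makes limits unique. Density
supplies such a sequence. -/
theorem isMultipleIntegral_iff (hX : IsQBrownianMotion P q X) (hq : |q| < 1) {n : ℕ}
    {f : (Fin n → ℝ) → ℂ} (hf : MemLp f 2 (halfLebesgue (Fin n))) (Y : P.Carrier) :
    IsMultipleIntegral X f Y ↔ Y = multipleIntegral X n (hf.toLp f) := by
  constructor
  · rintro ⟨s, hs, hY⟩
    exact P.eq_of_tendsto_trace hY
      (hX.tendsto_trace_simpleIntegrand hq ((tendsto_toLp_iff s hf).2 hs))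
  · rintro rfl
    obtain ⟨u, hu, hlim⟩ :=
      mem_closure_iff_seq_limit.1 (SimpleIntegrand.denseRange_toLp (hf.toLp f))
    choose s hs using hu
    have hlim' : Tendsto (fun k => (s k).toLp) atTop (𝓝 (hf.toLp f)) := by
      simpa only [hs] using hlim
    exact ⟨s, (tendsto_toLp_iff s hf).1 hlim', hX.tendsto_trace_simpleIntegrand hq hlim'⟩

/-- Both sides are continuous in the integrands and agree on the dense set of simple ones. On the
left this uses operator norm continuity of the integral, as products are jointly continuous in that
norm. -/
theorem trace_prod_multipleIntegral (hX : IsQBrownianMotion P q X) (hq : |q| < 1) {r : ℕ}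
    {n : Fin r → ℕ} (f : ∀ i, Lp ℂ 2 (halfLebesgue (Fin (n i)))) :
    P.trace (List.ofFn fun i => multipleIntegral X (n i) (f i)).prod =
      weightedPairingIntegral q n f := by
  have hdense : DenseRange (Pi.map fun i => (SimpleIntegrand.toLp : SimpleIntegrand (n i) → _)) :=
    DenseRange.piMap fun i => SimpleIntegrand.denseRange_toLp
  have hprod : Continuous fun Y : Fin r → P.Carrier => (List.ofFn Y).prod :=
    (ContinuousMultilinearMap.mkPiAlgebraFin ℂ r P.Carrier).cont
  have hL : Continuous fun f : ∀ i, Lp ℂ 2 (halfLebesgue (Fin (n i))) =>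
      P.trace (List.ofFn fun i => multipleIntegral X (n i) (f i)).prod :=
    P.continuous_trace.comp (hprod.comp (by fun_prop))
  refine congrFun (hdense.equalizer hL (weightedPairingIntegral q n).cont (funext fun s => ?_)) f
  simp only [Function.comp_apply, Pi.map, hX.multipleIntegral_toLp hq]
  exact hX.trace_prod_simpleIntegrand s

end IsQBrownianMotion

end

theorem theorem2p7 {H : Type*} [NormedAddCommGroup H] [InnerProductSpace ℂ H] [CompleteSpace H]
    (P : WStarProbabilitySpace H) (q : ℝ) (hq : q ∈ Set.Ioo (-1 : ℝ) 1)
    (X : ℝ≥0 → P.Carrier) (hX : IsQBrownianMotion P q X)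
    (r : ℕ) (n : Fin r → ℕ) (hn : ∀ i, 0 < n i)
    (f : ∀ i, (Fin (n i) → ℝ) → ℂ) (hf : ∀ i, MemLp (f i) 2 (halfLebesgue (Fin (n i)))) :
    (∀ i, ∃! Y : P.Carrier, IsMultipleIntegral X (f i) Y) ∧
    (∀ π : Pairing (∑ i, n i), π.Respects →
      Integrable (π.integrand f) (halfLebesgue π.Left)) ∧
    ∀ I : Fin r → P.Carrier, (∀ i, IsMultipleIntegral X (f i) (I i)) →
      P.trace (List.ofFn I).prod =
        ∑ π : Pairing (∑ i, n i) with π.Respects,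
          (q : ℂ) ^ π.crossings * π.integral f := by
  have hq' : |q| < 1 := abs_lt.2 hq
  refine ⟨fun i => ⟨multipleIntegral X (n i) ((hf i).toLp (f i)), ?_, fun Y hY => ?_⟩,
    fun π hπ => hπ.integrable_integrand hf, fun I hI => ?_⟩
  · exact (hX.isMultipleIntegral_iff hq' (hf i) _).2 rfl
  · exact (hX.isMultipleIntegral_iff hq' (hf i) Y).1 hY
  · obtain rfl : I = fun i => multipleIntegral X (n i) ((hf i).toLp (f i)) :=
      funext fun i => (hX.isMultipleIntegral_iff hq' (hf i) _).1 (hI i)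
    rw [hX.trace_prod_multipleIntegral hq', weightedPairingIntegral_apply]
    refine Finset.sum_congr rfl fun π hπ => congrArg _ ?_
    exact Pairing.Respects.integral_congr_ae (Finset.mem_filter.1 hπ).2
      fun i => (hf i).coeFn_toLp
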